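/- Let $\mathbb F$ be a field of characteristic $0$, $\mathcal V=\mathbb F[u_i^{(n)}\mid 1\le i\le \ell,\ n\ge 0]$ the algebra of differential polynomials with $\partial u_i^{(n)}=u_i^{(n+1)}$, $\mathcal K$ its field of fractions, and $\widetilde{\mathcal K}$ a linear closure of $\mathcal K$, i.e. a smallest differential field extension of $\mathcal K$ that is linearly closed (every equation $a_nu^{(n)}+\dots+a_1u'+a_0u=b$ with coefficients in it and $a_n\ne0$ has a solution in it, and a nonzero one if $b=0$, $n\ge1$) and whose field of constants is the algebraic closure of the field of constants of $\mathcal K$. A local Poisson structure is a skewadjoint $H\in\mathrm{Mat}_{\ell\times\ell}\mathcal V[\partial]$ whose $\lambda$-bracket $$\{f_\lambda g\}_H=\sum_{i,j,m,n}\frac{\partial g}{\partial u_j^{(n)}}(\lambda+\partial)^nH_{ji}(\lambda+\partial)(-\lambda-\partial)^m\frac{\partial f}{\partial u_i^{(m)}}$$ satisfies the Jacobi identity $\{f_\lambda\{g_\mu h\}\}-\{g_\mu\{f_\lambda h\}\}=\{\{f_\lambda g\}_{\lambda+\mu}h\}$; $(H_0,H_1)$ is a local bi-Poisson structure if all $\mathbb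 F$-linear combinations of $H_0$ and $H_1$ are local Poisson structures. For a rational $H\in\mathrm{Mat}_{\ell\times\ell}\mathcal V((\partial^{-1}))$ and $\xi,P\in\mathcal V^\ell$, write $\xi\overset{H}{\longleftrightarrow}P$ if there are $A,B\in\mathrm{Mat}_{\ell\times\ell}\mathcal V[\partial]$, with $B$ invertible in $\mathrm{Mat}_{\ell\times\ell}\mathcal K((\partial^{-1}))$ and $H=AB^{-1}$, and $F\in\mathcal K^\ell$ such that $\xi=BF$ and $P=AF$. Let $(H_0,H_1)$ be a local bi-Poisson structure on $\mathcal V$, and let $h_n\in\mathcal V$ $(n\ge-1)$ be densities of local functionals and $P_n\in\mathcal V^\ell$ $(n\ge0)$ satisfy the Lenard–Magri relations $$\frac{\delta h_{n-1}}{\delta u}\overset{H_1}{\longleftrightarrow}P_n,\qquad \frac{\delta h_n}{\delta u}\overset{H_0}{\longleftrightarrow}P_n\qquad\text{for all } n\ge0 .$$ Let $\theta_1,\dots,\theta_m\in\mathcal V$ be central for $H_0$, i.e. $\{f_\lambda\theta_\alpha\}_{H_0}=\{{\theta_\alpha}_\lambda f\}_{H_0}=0$ for all $f\in\mathcal V$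 and all $\alpha$. Let $D_\theta$ be the Fréchet derivative, $(D_\theta)_{\alpha i}=\sum_n\frac{\partial\theta_\alpha}{\partial u_i^{(n)}}\partial^n$, and let $B=H_1\circ D_\theta^*$ and $C=D_\theta\circ H_1\circ D_\theta^*$. Assume that $C$ is invertible in $\mathrm{Mat}_{m\times m}\mathcal V((\partial^{-1}))$, and let $H_1^D=H_1+B\circ C^{-1}\circ B^*$ be the Dirac modification of $H_1$. If $\operatorname{Ker}B$ and $\operatorname{Ker}C$ have zero intersection in $\widetilde{\mathcal K}^m$, then $$\frac{\delta h_{n-1}}{\delta u}\overset{H_1^D}{\longleftrightarrow}P_n,\qquad \frac{\delta h_n}{\delta u}\overset{H_0}{\longleftrightarrow}P_n\qquad\text{for all } n\ge0 .$$ -/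

import Mathlib

set_option linter.unusedSectionVars false

open scoped Differential

noncomputable section

namespace DiracReduction

section PsDO

variable {R : Type*} [CommRing R] [Differential R]

/-- The `n`-th power of the derivation of a differential ring. -/
def derivPow (n : ℕ) : R →ₗ[ℤ] R := (Differential.deriv : Derivation ℤ R R).toLinearMap ^ n

theorem derivPow_zero (x : R) : derivPow 0 x = x := rfl

theorem derivPow_succ (n : ℕ) (x : R) : derivPow (n + 1) x = (derivPow n x)′ := by
  simp only [derivPow, pow_succ']; rfl

theorem derivPow_add (m n : ℕ) (x : R) : derivPow (m + n) x = derivPow m (derivPow n x) := by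
  simp only [derivPow, pow_add]; rfl

theorem derivPow_one_eq_zero (n : ℕ) (hn : n ≠ 0) : derivPow n (1 : R) = 0 := by
  obtain ⟨k, rfl⟩ := Nat.exists_eq_succ_of_ne_zero hn
  rw [Nat.succ_eq_add_one, derivPow_add]
  have : derivPow 1 (1 : R) = 0 := by rw [← zero_add 1, derivPow_succ, derivPow_zero]; simp
  rw [this, map_zero]

theorem derivPow_mul (n : ℕ) (a b : R) :
    derivPow n (a * b) = ∑ ij ∈ Finset.HasAntidiagonal.antidiagonal n,
      (n.choose ij.1 : R) * (derivPow ij.1 a * derivPow ij.2 b) := by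
  induction n with
  | zero => simp [derivPow_zero]
  | succ n ih =>
    have key := Finset.sum_antidiagonal_choose_succ_nsmul (M := R)
      (fun i j => derivPow i a * derivPow j b) n
    simp only [nsmul_eq_mul] at key
    rw [key, derivPow_succ, ih, map_sum, ← Finset.sum_add_distrib]
    refine Finset.sum_congr rfl fun ⟨i, j⟩ hij ↦ ?_
    have h2 : n.choose j = n.choose i := (n.choose_symm_of_eq_add (Finset.HasAntidiagonal.mem_antidiagonal.1 hij).symm).symm
    simp only [Derivation.leibniz, smul_eq_mul, derivPow_succ, Derivation.map_natCast, h2]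
    ring

variable (R) in
/-- Sequences of coefficients indexed by `ℤ` and vanishing for all large indices. -/
def boundedAbove : AddSubgroup (ℤ → R) where
  carrier := {a | ∃ N : ℤ, ∀ n, N < n → a n = 0}
  zero_mem' := ⟨0, fun _ _ => rfl⟩
  add_mem' := by
    rintro a b ⟨N, hN⟩ ⟨M, hM⟩
    refine ⟨max N M, fun n hn => ?_⟩
    simp [hN n (lt_of_le_of_lt (le_max_left _ _) hn), hM n (lt_of_le_of_lt (le_max_right _ _) hn)]
  neg_mem' := by
    rintro a ⟨N, hN⟩
    exact ⟨N, fun n hn => by simp [hN n hn]⟩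

variable (R) in
/-- Pseudodifferential operators `∑_{n ≤ N} aₙ ∂ⁿ` with coefficients in `R`, written with the
coefficients on the left. -/
def PsDO : Type _ := boundedAbove R

instance : AddCommGroup (PsDO R) := inferInstanceAs (AddCommGroup (boundedAbove R))

/-- The coefficient of `∂ⁿ`. -/
def PsDO.coeff (a : PsDO R) (n : ℤ) : R := a.1 n

namespace PsDO

@[ext] theorem ext {a b : PsDO R} (h : ∀ n, a.coeff n = b.coeff n) : a = b :=
  Subtype.ext (funext h)

theorem exists_bound (a : PsDO R) : ∃ N : ℤ, ∀ n, a.coeff n ≠ 0 → n ≤ N := by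
  obtain ⟨N, hN⟩ := a.2
  exact ⟨N, fun n hn => not_lt.1 fun h => hn (hN n h)⟩

@[simp] theorem coeff_zero (n : ℤ) : (0 : PsDO R).coeff n = 0 := rfl
@[simp] theorem coeff_add (a b : PsDO R) (n : ℤ) : (a + b).coeff n = a.coeff n + b.coeff n := rfl
@[simp] theorem coeff_neg (a : PsDO R) (n : ℤ) : (-a).coeff n = -a.coeff n := rfl

/-- The contribution of `aₘ ∂ᵐ ∘ bₙ ∂ⁿ = ∑ⱼ (m choose j) aₘ bₙ⁽ʲ⁾ ∂ᵐ⁺ⁿ⁻ʲ` to the coefficient of `∂ᵏ`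
in a product, for `p = (m, j)` and `n = k - m + j`. -/
def mulTerm (a b : PsDO R) (k : ℤ) (p : ℤ × ℕ) : R :=
  (Ring.choose p.1 p.2 : ℤ) * (a.coeff p.1 * derivPow p.2 (b.coeff (k - p.1 + p.2)))

theorem mulTerm_ne_zero {a b : PsDO R} {k : ℤ} {p : ℤ × ℕ} (h : mulTerm a b k p ≠ 0) :
    a.coeff p.1 ≠ 0 ∧ b.coeff (k - p.1 + p.2) ≠ 0 := by
  constructor <;> (intro h0; apply h; simp [mulTerm, h0])

theorem mulTerm_finite (a b : PsDO R) (k : ℤ) : (mulTerm a b k).HasFiniteSupport := by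
  obtain ⟨A, hA⟩ := a.exists_bound
  obtain ⟨B, hB⟩ := b.exists_bound
  refine ((Set.finite_Icc (k - B) A).prod (Set.finite_Iic (B - k + A).toNat)).subset ?_
  intro p hp
  obtain ⟨h1, h2⟩ := mulTerm_ne_zero hp
  have := hA _ h1
  have := hB _ h2
  simp only [Set.mem_prod, Set.mem_Icc, Set.mem_Iic]
  omega

/-- Composition of pseudodifferential operators, determined by
`∂ᵐ ∘ f = ∑ⱼ (m choose j) f⁽ʲ⁾ ∂ᵐ⁻ʲ`, `m ∈ ℤ`. -/
instance : Mul (PsDO R) where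
  mul a b := ⟨fun k => ∑ᶠ p : ℤ × ℕ, mulTerm a b k p, by
    obtain ⟨A, hA⟩ := a.exists_bound
    obtain ⟨B, hB⟩ := b.exists_bound
    refine ⟨A + B, fun k hk => ?_⟩
    rw [← finsum_zero (α := ℤ × ℕ)]
    refine finsum_congr fun p => ?_
    by_contra h
    obtain ⟨h1, h2⟩ := mulTerm_ne_zero h
    have := hA _ h1
    have := hB _ h2
    omega⟩

theorem coeff_mul (a b : PsDO R) (k : ℤ) : (a * b).coeff k = ∑ᶠ p, mulTerm a b k p := rfl

/-- The operator `r ∂ⁿ`. -/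
def single (n : ℤ) (r : R) : PsDO R :=
  ⟨Pi.single n r, n, fun k hk => by simp [hk.ne']⟩

theorem coeff_single (n : ℤ) (r : R) (k : ℤ) :
    (single n r).coeff k = if k = n then r else 0 := by
  simp [single, coeff, Pi.single_apply]

instance : One (PsDO R) := ⟨single 0 1⟩

theorem coeff_one (k : ℤ) : (1 : PsDO R).coeff k = if k = 0 then 1 else 0 := coeff_single 0 1 k

theorem finsum_antidiagonal {M : Type*} [AddCommMonoid M] (f : ℕ × ℕ → M)
    (hf : f.HasFiniteSupport) :
    ∑ᶠ s : ℕ, ∑ x ∈ Finset.HasAntidiagonal.antidiagonal s, f x = ∑ᶠ x, f x := by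
  have h1 : ∀ s : ℕ, ∑ x ∈ Finset.HasAntidiagonal.antidiagonal s, f x
      = ∑ x ∈ hf.toFinset, if x.1 + x.2 = s then f x else 0 := by
    intro s
    rw [← Finset.sum_filter]
    symm
    refine Finset.sum_subset_zero_on_sdiff (fun x hx => ?_) (fun x hx => ?_) fun _ _ => rfl
    · simpa using (Finset.mem_filter.1 hx).2
    · rw [Finset.mem_sdiff, Finset.HasAntidiagonal.mem_antidiagonal, Finset.mem_filter] at hx
      by_contra h
      exact hx.2 ⟨hf.mem_toFinset.2 h, hx.1⟩
  simp_rw [h1]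
  rw [finsum_sum_comm]
  · rw [finsum_eq_sum _ hf]
    refine Finset.sum_congr rfl fun x _ => ?_
    rw [finsum_eq_single _ (x.1 + x.2) (fun s hs => if_neg hs.symm), if_pos rfl]
  · intro x _
    refine (Set.finite_singleton (x.1 + x.2)).subset fun s hs => ?_
    by_contra h
    exact hs (if_neg fun h' => h h'.symm)

/-- The common form of the coefficients of `(a b) c` and `a (b c)`. -/
def assocTerm (a b c : PsDO R) (k : ℤ) (m n : ℤ) (i u t : ℕ) : R :=
  ((Ring.choose m i * Ring.choose (m - i) u * Ring.choose n t : ℤ) : R) *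
    (a.coeff m * derivPow i (b.coeff n) * derivPow (u + t) (c.coeff (k - m - n + i + u + t)))

theorem assocTerm_ne_zero {a b c : PsDO R} {k m n : ℤ} {i u t : ℕ}
    (h : assocTerm a b c k m n i u t ≠ 0) :
    a.coeff m ≠ 0 ∧ b.coeff n ≠ 0 ∧ c.coeff (k - m - n + i + u + t) ≠ 0 := by
  refine ⟨?_, ?_, ?_⟩ <;> (intro h0; apply h; simp [assocTerm, h0])

theorem assocTerm_finite (a b c : PsDO R) (k : ℤ) :
    (fun x : ℤ × ℤ × ℕ × ℕ × ℕ =>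
      assocTerm a b c k x.1 x.2.1 x.2.2.1 x.2.2.2.1 x.2.2.2.2).HasFiniteSupport := by
  obtain ⟨A, hA⟩ := a.exists_bound
  obtain ⟨B, hB⟩ := b.exists_bound
  obtain ⟨C, hC⟩ := c.exists_bound
  have hI := Set.finite_Iic (C - k + A + B).toNat
  refine ((Set.finite_Icc (k - C - B) A).prod ((Set.finite_Icc (k - C - A) B).prod
    (hI.prod (hI.prod hI)))).subset ?_
  rintro ⟨m, n, i, u, t⟩ hp
  obtain ⟨h1, h2, h3⟩ := assocTerm_ne_zero hp
  replace h1 : m ≤ A := hA _ h1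
  replace h2 : n ≤ B := hB _ h2
  replace h3 : k - m - n + i + u + t ≤ C := hC _ h3
  simp only [Set.mem_prod, Set.mem_Icc, Set.mem_Iic] at *
  omega

theorem finite_of_inj {α β M : Type*} [Zero M] {f : α → M} (hf : f.HasFiniteSupport)
    (g : β → α) (hg : Function.Injective g) : (fun x => f (g x)).HasFiniteSupport :=
  Set.Finite.preimage (f := g) hg.injOn hf

theorem coeff_mul_mul_left (a b c : PsDO R) (k : ℤ) :
    (a * b * c).coeff k = ∑ᶠ x : (ℤ × ℤ × ℕ) × (ℕ × ℕ),
      assocTerm a b c k x.1.1 x.1.2.1 x.1.2.2 x.2.1 x.2.2 := by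
  have hfin : (fun x : (ℤ × ℤ × ℕ) × (ℕ × ℕ) =>
      assocTerm a b c k x.1.1 x.1.2.1 x.1.2.2 x.2.1 x.2.2).HasFiniteSupport :=
    finite_of_inj (assocTerm_finite a b c k)
      (fun x : (ℤ × ℤ × ℕ) × (ℕ × ℕ) => (x.1.1, x.1.2.1, x.1.2.2, x.2.1, x.2.2))
      (by rintro ⟨⟨_, _, _⟩, _, _⟩ ⟨⟨_, _, _⟩, _, _⟩ h; simp_all)
  -- the terms obtained by expanding both products
  let L : (ℤ × ℕ) × (ℤ × ℕ) → R := fun y =>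
    (Ring.choose y.1.1 y.1.2 : ℤ) * (mulTerm a b y.1.1 y.2 *
      derivPow y.1.2 (c.coeff (k - y.1.1 + y.1.2)))
  let e : (ℤ × ℤ × ℕ) × ℕ ≃ (ℤ × ℕ) × (ℤ × ℕ) :=
    { toFun := fun x => ((x.1.1 + x.1.2.1 - x.1.2.2, x.2), (x.1.1, x.1.2.2))
      invFun := fun y => ((y.2.1, y.1.1 - y.2.1 + y.2.2, y.2.2), y.1.2)
      left_inv := by rintro ⟨⟨m, n, i⟩, s⟩; simp; ring
      right_inv := by rintro ⟨⟨m, n⟩, i, s⟩; simp; ring }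
  have hLe : ∀ m n i s, L (e ((m, n, i), s)) =
      ∑ x ∈ Finset.HasAntidiagonal.antidiagonal s, assocTerm a b c k m n i x.1 x.2 := by
    intro m n i s
    have h1 : m + n - (i : ℤ) - m + i = n := by ring
    have h2 : m + n - (i : ℤ) = (m - i) + n := by ring
    simp only [L, e, Equiv.coe_fn_mk, mulTerm, h1]
    rw [h2, Ring.add_choose_eq s (Commute.all _ _)]
    push_cast
    rw [Finset.sum_mul]
    refine Finset.sum_congr rfl fun x hx => ?_
    have hx := Finset.HasAntidiagonal.mem_antidiagonal.1 hx
    subst hx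
    have h3 : k - (m - i + n) + ((x.1 + x.2 : ℕ) : ℤ) = k - m - n + i + x.1 + x.2 := by
      push_cast; ring
    rw [assocTerm, h3]
    push_cast
    ring
  have hL : L.HasFiniteSupport := by
    obtain ⟨A, hA⟩ := a.exists_bound
    obtain ⟨B, hB⟩ := b.exists_bound
    obtain ⟨C, hC⟩ := c.exists_bound
    have hI := Set.finite_Iic (C - k + A + B).toNat
    refine (((Set.finite_Icc (k - C) (A + B)).prod hI).prod
      ((Set.finite_Icc (k - C - B) A).prod hI)).subset ?_
    rintro ⟨⟨p, s⟩, m, i⟩ hp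
    have hc : c.coeff (k - p + s) ≠ 0 := by intro h; apply hp; simp [L, h]
    have hab : mulTerm a b p (m, i) ≠ 0 := by intro h; apply hp; simp [L, h]
    obtain ⟨h1, h2⟩ := mulTerm_ne_zero hab
    replace h1 : m ≤ A := hA _ h1
    replace h2 : p - m + i ≤ B := hB _ h2
    replace hc := hC _ hc
    simp only [Set.mem_prod, Set.mem_Icc, Set.mem_Iic]
    omega
  calc (a * b * c).coeff k
      = ∑ᶠ q : ℤ × ℕ, ∑ᶠ p : ℤ × ℕ, L (q, p) := by
        rw [coeff_mul]
        refine finsum_congr fun q => ?_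
        rw [mulTerm, coeff_mul, finsum_mul' _ _ (mulTerm_finite a b q.1), mul_finsum']
        exact (mulTerm_finite a b q.1).subset fun x hx h0 => hx (by simp [h0])
    _ = ∑ᶠ y, L y := (finsum_curry L hL).symm
    _ = ∑ᶠ x, L (e x) := (finsum_comp_equiv e).symm
    _ = ∑ᶠ z : ℤ × ℤ × ℕ, ∑ᶠ s : ℕ, L (e (z, s)) :=
        finsum_curry (fun x => L (e x)) (finite_of_inj hL e e.injective)
    _ = ∑ᶠ z : ℤ × ℤ × ℕ, ∑ᶠ x : ℕ × ℕ, assocTerm a b c k z.1 z.2.1 z.2.2 x.1 x.2 := by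
        refine finsum_congr fun z => ?_
        rw [← finsum_antidiagonal (fun x : ℕ × ℕ => assocTerm a b c k z.1 z.2.1 z.2.2 x.1 x.2)
          (finite_of_inj hfin (fun x => (z, x)) fun _ _ h => (Prod.ext_iff.1 h).2)]
        exact finsum_congr fun s => hLe z.1 z.2.1 z.2.2 s
    _ = _ := (finsum_curry _ hfin).symm

theorem coeff_mul_mul_right (a b c : PsDO R) (k : ℤ) :
    (a * (b * c)).coeff k = ∑ᶠ x : (ℤ × ℤ × ℕ) × (ℕ × ℕ),
      assocTerm a b c k x.1.1 x.1.2.1 x.2.1 x.2.2 x.1.2.2 := by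
  have hfin : (fun x : (ℤ × ℤ × ℕ) × (ℕ × ℕ) =>
      assocTerm a b c k x.1.1 x.1.2.1 x.2.1 x.2.2 x.1.2.2).HasFiniteSupport :=
    finite_of_inj (assocTerm_finite a b c k)
      (fun x : (ℤ × ℤ × ℕ) × (ℕ × ℕ) => (x.1.1, x.1.2.1, x.2.1, x.2.2, x.1.2.2))
      (by rintro ⟨⟨_, _, _⟩, _, _⟩ ⟨⟨_, _, _⟩, _, _⟩ h; simp_all)
  -- the terms obtained by expanding both products
  let L : (ℤ × ℕ) × (ℤ × ℕ) → R := fun y =>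
    (Ring.choose y.1.1 y.1.2 : ℤ) * (a.coeff y.1.1 *
      derivPow y.1.2 (mulTerm b c (k - y.1.1 + y.1.2) y.2))
  let e : (ℤ × ℤ × ℕ) × ℕ ≃ (ℤ × ℕ) × (ℤ × ℕ) :=
    { toFun := fun x => ((x.1.1, x.2), (x.1.2.1, x.1.2.2))
      invFun := fun y => ((y.1.1, y.2.1, y.2.2), y.1.2)
      left_inv := fun _ => rfl
      right_inv := fun _ => rfl }
  have hLe : ∀ m n t j, L (e ((m, n, t), j)) =
      ∑ x ∈ Finset.HasAntidiagonal.antidiagonal j, assocTerm a b c k m n x.1 x.2 t := by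
    intro m n t j
    simp only [L, e, Equiv.coe_fn_mk, mulTerm]
    rw [← zsmul_eq_mul (derivPow t _ |> fun z => b.coeff n * z), map_zsmul, derivPow_mul,
      zsmul_eq_mul, Finset.mul_sum, Finset.mul_sum, Finset.mul_sum]
    refine Finset.sum_congr rfl fun x hx => ?_
    have hx := Finset.HasAntidiagonal.mem_antidiagonal.1 hx
    subst hx
    have h3 : k - m + ((x.1 + x.2 : ℕ) : ℤ) - n + t = k - m - n + x.1 + x.2 + t := by
      push_cast; ring
    have h4 := Ring.choose_smul_choose m (Nat.le_add_right x.1 x.2)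
    rw [Nat.add_sub_cancel_left, nsmul_eq_mul] at h4
    have h5 := congrArg (fun z : ℤ => (z : R)) h4
    push_cast at h5
    rw [assocTerm, h3, derivPow_add]
    push_cast
    rw [← h5]
    ring
  have hL : L.HasFiniteSupport := by
    obtain ⟨A, hA⟩ := a.exists_bound
    obtain ⟨B, hB⟩ := b.exists_bound
    obtain ⟨C, hC⟩ := c.exists_bound
    have hI := Set.finite_Iic (C - k + A + B).toNat
    refine (((Set.finite_Icc (k - C - B) A).prod hI).prod
      ((Set.finite_Icc (k - C - A) B).prod hI)).subset ?_
    rintro ⟨⟨m, j⟩, n, t⟩ hp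
    have h1 : a.coeff m ≠ 0 := by intro h; apply hp; simp [L, h]
    have hbc : mulTerm b c (k - m + j) (n, t) ≠ 0 := by intro h; apply hp; simp [L, h]
    obtain ⟨h2, h3⟩ := mulTerm_ne_zero hbc
    replace h1 : m ≤ A := hA _ h1
    replace h2 : n ≤ B := hB _ h2
    replace h3 : k - m + j - n + t ≤ C := hC _ h3
    simp only [Set.mem_prod, Set.mem_Icc, Set.mem_Iic]
    omega
  calc (a * (b * c)).coeff k
      = ∑ᶠ q : ℤ × ℕ, ∑ᶠ p : ℤ × ℕ, L (q, p) := by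
        rw [coeff_mul]
        refine finsum_congr fun q => ?_
        have hf := mulTerm_finite b c (k - q.1 + q.2)
        have h1 : derivPow q.2 (∑ᶠ p, mulTerm b c (k - q.1 + q.2) p) =
            ∑ᶠ p, derivPow q.2 (mulTerm b c (k - q.1 + q.2) p) :=
          (derivPow (R := R) q.2).toAddMonoidHom.map_finsum hf
        have hf' : (fun p => derivPow q.2 (mulTerm b c (k - q.1 + q.2) p)).HasFiniteSupport :=
          hf.subset fun x hx h0 => hx (by simp [h0])
        rw [mulTerm, coeff_mul, h1, mul_finsum' _ _ hf', mul_finsum']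
        exact hf'.subset fun x hx h0 => hx (by simp only [h0, mul_zero])
    _ = ∑ᶠ y, L y := (finsum_curry L hL).symm
    _ = ∑ᶠ x, L (e x) := (finsum_comp_equiv e).symm
    _ = ∑ᶠ z : ℤ × ℤ × ℕ, ∑ᶠ j : ℕ, L (e (z, j)) :=
        finsum_curry (fun x => L (e x)) (finite_of_inj hL e e.injective)
    _ = ∑ᶠ z : ℤ × ℤ × ℕ, ∑ᶠ x : ℕ × ℕ, assocTerm a b c k z.1 z.2.1 x.1 x.2 z.2.2 := by
        refine finsum_congr fun z => ?_
        rw [← finsum_antidiagonal (fun x : ℕ × ℕ => assocTerm a b c k z.1 z.2.1 x.1 x.2 z.2.2)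
          (finite_of_inj hfin (fun x => (z, x)) fun _ _ h => (Prod.ext_iff.1 h).2)]
        exact finsum_congr fun s => hLe z.1 z.2.1 z.2.2 s
    _ = _ := (finsum_curry _ hfin).symm

instance : Ring (PsDO R) where
  __ := (inferInstance : AddCommGroup (PsDO R))
  left_distrib a b c := by
    ext k
    rw [coeff_add]
    simp only [coeff_mul]
    rw [← finsum_add_distrib (mulTerm_finite a b k) (mulTerm_finite a c k)]
    exact finsum_congr fun p => by simp only [mulTerm, coeff_add, map_add]; ring
  right_distrib a b c := by
    ext k
    rw [coeff_add]
    simp only [coeff_mul]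
    rw [← finsum_add_distrib (mulTerm_finite a c k) (mulTerm_finite b c k)]
    exact finsum_congr fun p => by simp only [mulTerm, coeff_add]; ring
  zero_mul a := by
    ext k
    exact (finsum_congr fun p => by simp [mulTerm]).trans (finsum_zero (α := ℤ × ℕ))
  mul_zero a := by
    ext k
    exact (finsum_congr fun p => by simp [mulTerm]).trans (finsum_zero (α := ℤ × ℕ))
  one_mul a := by
    ext k
    rw [coeff_mul, finsum_eq_single _ (0, 0)]
    · simp [mulTerm, coeff_one, derivPow_zero]
    · rintro ⟨m, j⟩ h
      by_cases hm : m = 0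
      · subst hm
        have hj : j ≠ 0 := by rintro rfl; exact h rfl
        simp [mulTerm, Ring.choose_zero_pos ℤ (Nat.pos_of_ne_zero hj)]
      · simp [mulTerm, coeff_one, hm]
  mul_one a := by
    ext k
    rw [coeff_mul, finsum_eq_single _ (k, 0)]
    · simp [mulTerm, coeff_one, derivPow_zero]
    · rintro ⟨m, j⟩ h
      simp only [mulTerm, coeff_one]
      split_ifs with h1
      · have hj : j ≠ 0 := by
          rintro rfl
          apply h
          have : k = m := by simpa [sub_eq_zero] using h1
          rw [this]
        simp [derivPow_one_eq_zero j hj]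
      · simp
  mul_assoc a b c := by
    ext k
    rw [coeff_mul_mul_left, coeff_mul_mul_right]
    let e : (ℤ × ℤ × ℕ) × (ℕ × ℕ) ≃ (ℤ × ℤ × ℕ) × (ℕ × ℕ) :=
      { toFun := fun x => ((x.1.1, x.1.2.1, x.2.2), (x.1.2.2, x.2.1))
        invFun := fun x => ((x.1.1, x.1.2.1, x.2.1), (x.2.2, x.1.2.2))
        left_inv := fun _ => rfl
        right_inv := fun _ => rfl }
    exact finsum_eq_of_bijective e e.bijective fun _ => rfl


/-- The formal adjoint `(∑ aₙ ∂ⁿ)* = ∑ (-∂)ⁿ ∘ aₙ`; the coefficient of `∂ᵏ` collects the terms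
`(-1)ⁿ (n choose j) aₙ⁽ʲ⁾ ∂ⁿ⁻ʲ` with `n = k + j`. -/
def adjoint (a : PsDO R) : PsDO R :=
  ⟨fun k => ∑ᶠ j : ℕ, (((k + j).negOnePow : ℤ) * Ring.choose (k + j) j : ℤ) *
      derivPow j (a.coeff (k + j)), by
    obtain ⟨A, hA⟩ := a.exists_bound
    refine ⟨A, fun k hk => (finsum_congr fun j => ?_).trans (finsum_zero (α := ℕ))⟩
    have h : a.coeff (k + j) = 0 := by
      by_contra h
      have := hA _ h
      omega
    rw [h, map_zero, mul_zero]⟩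

theorem coeff_adjoint (a : PsDO R) (k : ℤ) : (adjoint a).coeff k =
    ∑ᶠ j : ℕ, (((k + j).negOnePow : ℤ) * Ring.choose (k + j) j : ℤ) *
      derivPow j (a.coeff (k + j)) := rfl

/-- Change of coefficients along a ring homomorphism. -/
def map {S : Type*} [CommRing S] [Differential S] (φ : R →+* S) (a : PsDO R) : PsDO S :=
  ⟨fun k => φ (a.coeff k), by
    obtain ⟨A, hA⟩ := a.exists_bound
    refine ⟨A, fun k hk => ?_⟩
    have h : a.coeff k = 0 := by
      by_contra h
      exact absurd (hA _ h) (not_le.2 hk)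
    dsimp only
    rw [h, map_zero]⟩

end PsDO

theorem choose_eq_zero_of_lt {m : ℤ} {j : ℕ} (h0 : 0 ≤ m) (h : m < j) : Ring.choose m j = 0 := by
  obtain ⟨n, rfl⟩ := Int.eq_ofNat_of_zero_le h0
  have := Ring.choose_natCast (R := ℤ) n j
  rw [this, Nat.choose_eq_zero_of_lt (by exact_mod_cast h), Nat.cast_zero]

variable (R) in
/-- The differential operators, i.e. the pseudodifferential operators without negative powers of
`∂`. -/
def diffOps : Subring (PsDO R) where
  carrier := {a | ∀ n < 0, a.coeff n = 0}
  zero_mem' := fun _ _ => rfl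
  one_mem' := fun n hn => by rw [PsDO.coeff_one, if_neg hn.ne]
  add_mem' := fun ha hb n hn => by rw [PsDO.coeff_add, ha n hn, hb n hn, add_zero]
  neg_mem' := fun ha n hn => by rw [PsDO.coeff_neg, ha n hn, neg_zero]
  mul_mem' := by
    intro a b ha hb k hk
    rw [PsDO.coeff_mul]
    refine (finsum_congr fun p => ?_).trans (finsum_zero (α := ℤ × ℕ))
    by_contra h
    obtain ⟨h1, h2⟩ := PsDO.mulTerm_ne_zero h
    have h3 : 0 ≤ p.1 := not_lt.1 fun h3 => h1 (ha _ h3)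
    have h4 : 0 ≤ k - p.1 + p.2 := not_lt.1 fun h3 => h2 (hb _ h3)
    exact h (by rw [PsDO.mulTerm, choose_eq_zero_of_lt h3 (by omega), Int.cast_zero, zero_mul])

variable (R) in
/-- The ring `R[∂]` of differential operators. -/
abbrev DiffOp : Type _ := diffOps R

namespace DiffOp

/-- The coefficient of `∂ⁿ`. -/
def coeff (a : DiffOp R) (n : ℕ) : R := (a : PsDO R).coeff n

/-- The operator of multiplication by `r`. -/
def const (r : R) : DiffOp R :=
  ⟨PsDO.single 0 r, fun n hn => by rw [PsDO.coeff_single, if_neg hn.ne]⟩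

/-- The action `f ↦ ∑ₙ aₙ f⁽ⁿ⁾` of a differential operator on an extension `φ : R → S`. -/
def act {S : Type*} [CommRing S] [Differential S] (φ : R →+* S) (a : DiffOp R) (f : S) : S :=
  ∑ᶠ n : ℕ, φ (a.coeff n) * derivPow n f

/-- The formal adjoint of a differential operator. -/
def adjoint (a : DiffOp R) : DiffOp R :=
  ⟨(a : PsDO R).adjoint, by
    intro k hk
    rw [PsDO.coeff_adjoint]
    refine (finsum_congr fun j => ?_).trans (finsum_zero (α := ℕ))
    by_cases h : k + j < 0
    · rw [a.2 _ h, map_zero, mul_zero]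
    · rw [choose_eq_zero_of_lt (not_lt.1 h) (by omega), mul_zero, Int.cast_zero, zero_mul]⟩

end DiffOp

section Matrices

variable {ι κ : Type*}

/-- A matrix differential operator regarded as a matrix pseudodifferential operator. -/
def toPsDO (A : Matrix ι κ (DiffOp R)) : Matrix ι κ (PsDO R) := A.map Subtype.val

/-- The adjoint of a matrix differential operator, `(A*)ᵢⱼ = (Aⱼᵢ)*`. -/
def matAdjoint (A : Matrix ι κ (DiffOp R)) : Matrix κ ι (DiffOp R) :=
  A.transpose.map DiffOp.adjoint

/-- The action of a matrix differential operator on vectors over an extension `φ : R → S`. -/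
def matAct {S : Type*} [CommRing S] [Differential S] [Fintype κ] (φ : R →+* S)
    (A : Matrix ι κ (DiffOp R)) (f : κ → S) : ι → S :=
  fun i => ∑ j, (A i j).act φ (f j)

end Matrices

end PsDO

section FractionField

/-- An additive map satisfying the Leibniz rule is a derivation over `ℤ`. -/
def derivationOfAdd {K : Type*} [CommRing K] (d : K →+ K)
    (hd : ∀ a b, d (a * b) = a • d b + b • d a) : Derivation ℤ K K :=
  Derivation.mk' d.toIntLinearMap hd

/-- The homomorphism `a ↦ a + a′ ε` to the dual numbers over the field of fractions. -/
def toDual (A : Type*) [CommRing A] [IsDomain A] [Differential A] :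
    A →+* DualNumber (FractionRing A) where
  toFun a := TrivSqZeroExt.inl (algebraMap A (FractionRing A) a) +
    TrivSqZeroExt.inr (algebraMap A (FractionRing A) a′)
  map_one' := by ext <;> simp
  map_zero' := by ext <;> simp
  map_add' a b := by
    ext
    · simp
    · simp only [map_add, TrivSqZeroExt.snd_add, TrivSqZeroExt.snd_inl, TrivSqZeroExt.snd_inr,
        zero_add]
  map_mul' a b := by
    ext
    · simp
    · simp only [Derivation.leibniz, smul_eq_mul, map_add, map_mul, TrivSqZeroExt.snd_add,
        TrivSqZeroExt.snd_mul, TrivSqZeroExt.fst_add, TrivSqZeroExt.snd_inl,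
        TrivSqZeroExt.snd_inr, TrivSqZeroExt.fst_inl, TrivSqZeroExt.fst_inr,
        MulOpposite.smul_eq_mul_unop, MulOpposite.unop_op, zero_add, add_zero]
      ring

/-- The extension of `a ↦ a + a′ ε` to the field of fractions. -/
def fracToDual (A : Type*) [CommRing A] [IsDomain A] [Differential A] :
    FractionRing A →+* DualNumber (FractionRing A) :=
  IsLocalization.lift (M := nonZeroDivisors A) (g := toDual A) (by
    intro y
    rw [TrivSqZeroExt.isUnit_iff_isUnit_fst]
    simp [toDual])

variable {A : Type*} [CommRing A] [IsDomain A] [Differential A]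

theorem fracToDual_algebraMap (a : A) :
    fracToDual A (algebraMap A (FractionRing A) a) = toDual A a :=
  IsLocalization.lift_eq _ a

theorem fst_fracToDual (x : FractionRing A) : (fracToDual A x).fst = x := by
  have h : (TrivSqZeroExt.fstHom (FractionRing A) (FractionRing A) (FractionRing A)).toRingHom.comp
      (fracToDual A) = RingHom.id _ := by
    refine IsLocalization.ringHom_ext (nonZeroDivisors A) ?_
    ext a
    simp [fracToDual_algebraMap, toDual]
  exact congrArg (fun f : FractionRing A →+* FractionRing A => f x) h

/-- The derivation of a differential domain extends to its field of fractions. -/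
instance : Differential (FractionRing A) where
  deriv := derivationOfAdd
    { toFun := fun x => (fracToDual A x).snd
      map_zero' := by simp
      map_add' := fun a b => by simp }
    (fun a b => by simp [fst_fracToDual, mul_comm])

instance : DifferentialAlgebra A (FractionRing A) where
  deriv_algebraMap a := by
    change (fracToDual A (algebraMap A (FractionRing A) a)).snd = _
    simp only [fracToDual_algebraMap, toDual, RingHom.coe_mk, MonoidHom.coe_mk, OneHom.coe_mk,
      TrivSqZeroExt.snd_add, TrivSqZeroExt.snd_inl, TrivSqZeroExt.snd_inr, zero_add]

end FractionField

section LinearClosure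

variable {L : Type*} [Field L] [Differential L]

variable (L) in
/-- The subfield of constants of a differential field. -/
def constants : Subfield L where
  carrier := {x | x′ = 0}
  mul_mem' := by
    intro a b (ha : a′ = 0) (hb : b′ = 0)
    change (a * b)′ = 0
    simp [ha, hb]
  one_mem' := by change (1 : L)′ = 0; simp
  add_mem' := by
    intro a b (ha : a′ = 0) (hb : b′ = 0)
    change (a + b)′ = 0
    simp [ha, hb]
  zero_mem' := by change (0 : L)′ = 0; simp
  neg_mem' := by
    intro a (ha : a′ = 0)
    change (-a)′ = 0
    simp [ha]
  inv_mem' := by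
    intro a (ha : a′ = 0)
    change (a⁻¹)′ = 0
    simp [Derivation.leibniz_inv, ha]

/-- A subfield `M` of a differential field is linearly closed if every linear differential equation
`aₙ u⁽ⁿ⁾ + ⋯ + a₁ u′ + a₀ u = b` with coefficients and right-hand side in `M` and `aₙ ≠ 0` has a
solution in `M`, and a nonzero solution in `M` if `b = 0` and `n ≥ 1`. -/
def IsLinearlyClosed (M : Subfield L) : Prop :=
  ∀ (n : ℕ) (a : ℕ → L), (∀ i, a i ∈ M) → a n ≠ 0 →
    (∀ b ∈ M, ∃ u ∈ M, ∑ i ∈ Finset.range (n + 1), a i * derivPow i u = b) ∧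
    (1 ≤ n → ∃ u ∈ M, u ≠ 0 ∧ ∑ i ∈ Finset.range (n + 1), a i * derivPow i u = 0)

/-- `L` is a linear closure of the differential field `K`: it is a linearly closed differential
field extension whose field of constants is an algebraic closure of the field of constants of `K`,
and it is the smallest such. -/
structure IsLinearClosure (K L : Type*) [Field K] [Differential K] [Field L] [Differential L]
    [Algebra K L] : Prop where
  differentialAlgebra : DifferentialAlgebra K L
  linearlyClosed : IsLinearlyClosed (⊤ : Subfield L)
  isAlgClosed_constants : IsAlgClosed (constants L)
  algebraic_constants : ∀ x ∈ constants L, ∃ p : Polynomial K, p ≠ 0 ∧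
    (∀ n, p.coeff n ∈ constants K) ∧ Polynomial.aeval x p = 0
  minimal : ∀ M : Subfield L, (∀ x, algebraMap K L x ∈ M) → constants L ≤ M →
    (∀ x ∈ M, x′ ∈ M) → IsLinearlyClosed M → M = ⊤

end LinearClosure

section DifferentialPolynomials

/-- The algebra of differential polynomials `F[uᵢ⁽ⁿ⁾]` in `ℓ` variables; the pair `(i, n)` stands for
`uᵢ⁽ⁿ⁾`. -/
abbrev DiffPoly (F : Type*) [CommRing F] (ℓ : ℕ) : Type _ := MvPolynomial (Fin ℓ × ℕ) F

variable {F : Type*} [Field F] {ℓ m : ℕ}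

/-- The derivation of `F[uᵢ⁽ⁿ⁾]` over `F` with `∂ uᵢ⁽ⁿ⁾ = uᵢ⁽ⁿ⁺¹⁾`. -/
instance : Differential (DiffPoly F ℓ) where
  deriv := (MvPolynomial.mkDerivation F fun x : Fin ℓ × ℕ =>
    (MvPolynomial.X (x.1, x.2 + 1) : DiffPoly F ℓ)).restrictScalars ℤ

theorem exists_order (f : DiffPoly F ℓ) :
    ∃ N : ℕ, ∀ i n, N < n → MvPolynomial.pderiv (i, n) f = 0 := by
  refine ⟨f.vars.sup Prod.snd, fun i n hn => MvPolynomial.pderiv_eq_zero_of_notMem_vars fun h => ?_⟩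
  exact absurd (Finset.le_sup (f := Prod.snd) h) (not_le.2 hn)

/-- The Fréchet derivative `(D_θ)_{αi} = ∑ₙ ∂θ_α/∂uᵢ⁽ⁿ⁾ ∂ⁿ`. -/
def frechet (θ : Fin m → DiffPoly F ℓ) : Matrix (Fin m) (Fin ℓ) (DiffOp (DiffPoly F ℓ)) :=
  fun α i => ⟨⟨fun k => if 0 ≤ k then MvPolynomial.pderiv (i, k.toNat) (θ α) else 0, by
      obtain ⟨N, hN⟩ := exists_order (θ α)
      refine ⟨N, fun k hk => ?_⟩
      dsimp only
      rw [if_pos (by omega), hN i k.toNat (by omega)]⟩,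
    fun k hk => if_neg (not_le.2 hk)⟩

/-- The variational derivative `δf/δuᵢ = ∑ₙ (-∂)ⁿ ∂f/∂uᵢ⁽ⁿ⁾`. -/
def variationalDerivative (f : DiffPoly F ℓ) (i : Fin ℓ) : DiffPoly F ℓ :=
  ∑ᶠ n : ℕ, (-1) ^ n * derivPow n (MvPolynomial.pderiv (i, n) f)

/-- Coefficientwise derivation on `V[λ]`. -/
def coeffDeriv (p : Polynomial (DiffPoly F ℓ)) : Polynomial (DiffPoly F ℓ) :=
  p.sum fun n a => Polynomial.monomial n (Differential.deriv a)

/-- The operator `λ + ∂` on `V[λ]`. -/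
def lamAddDeriv (p : Polynomial (DiffPoly F ℓ)) : Polynomial (DiffPoly F ℓ) :=
  Polynomial.X * p + coeffDeriv p

/-- The operator `-λ - ∂` on `V[λ]`. -/
def negLamSubDeriv (p : Polynomial (DiffPoly F ℓ)) : Polynomial (DiffPoly F ℓ) :=
  -lamAddDeriv p

/-- The operator `A(λ + ∂)` on `V[λ]`, for a differential operator `A(∂)`. -/
def actShift (A : DiffOp (DiffPoly F ℓ)) (p : Polynomial (DiffPoly F ℓ)) :
    Polynomial (DiffPoly F ℓ) :=
  ∑ᶠ k : ℕ, Polynomial.C (A.coeff k) * lamAddDeriv^[k] p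

/-- The `λ`-bracket of a matrix differential operator `H`, by the Master Formula
`{f_λ g} = ∑ ∂g/∂uⱼ⁽ⁿ⁾ (λ+∂)ⁿ Hⱼᵢ(λ+∂) (-λ-∂)ᵐ ∂f/∂uᵢ⁽ᵐ⁾`. The indices `(j, n)` and `(i, m)` only run
over the variables that occur in `g` and `f`. -/
def lamBracket (H : Matrix (Fin ℓ) (Fin ℓ) (DiffOp (DiffPoly F ℓ))) (f g : DiffPoly F ℓ) :
    Polynomial (DiffPoly F ℓ) :=
  ∑ y ∈ g.vars, ∑ x ∈ f.vars, Polynomial.C (MvPolynomial.pderiv y g) *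
    lamAddDeriv^[y.2] (actShift (H y.1 x.1)
      (negLamSubDeriv^[x.2] (Polynomial.C (MvPolynomial.pderiv x f))))

/-- `{f_λ {g_μ h}}` in `V[λ][μ]`. -/
def jacobiLeft (H : Matrix (Fin ℓ) (Fin ℓ) (DiffOp (DiffPoly F ℓ))) (f g h : DiffPoly F ℓ) :
    Polynomial (Polynomial (DiffPoly F ℓ)) :=
  (lamBracket H g h).sum fun n b => Polynomial.C (lamBracket H f b) * Polynomial.X ^ n

/-- `{g_μ {f_λ h}}` in `V[λ][μ]`. -/
def jacobiMiddle (H : Matrix (Fin ℓ) (Fin ℓ) (DiffOp (DiffPoly F ℓ))) (f g h : DiffPoly F ℓ) :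
    Polynomial (Polynomial (DiffPoly F ℓ)) :=
  (lamBracket H f h).sum fun n a =>
    Polynomial.C (Polynomial.X ^ n) * (lamBracket H g a).map Polynomial.C

/-- `{{f_λ g}_{λ+μ} h}` in `V[λ][μ]`. -/
def jacobiRight (H : Matrix (Fin ℓ) (Fin ℓ) (DiffOp (DiffPoly F ℓ))) (f g h : DiffPoly F ℓ) :
    Polynomial (Polynomial (DiffPoly F ℓ)) :=
  (lamBracket H f g).sum fun n c => Polynomial.C (Polynomial.X ^ n) *
    (lamBracket H c h).eval₂ (Polynomial.C.comp Polynomial.C)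
      (Polynomial.C Polynomial.X + Polynomial.X)

/-- A local Poisson structure: a skewadjoint matrix differential operator whose `λ`-bracket
satisfies the Jacobi identity. -/
structure IsPoisson (H : Matrix (Fin ℓ) (Fin ℓ) (DiffOp (DiffPoly F ℓ))) : Prop where
  skewadjoint : matAdjoint H = -H
  jacobi : ∀ f g h : DiffPoly F ℓ, jacobiLeft H f g h - jacobiMiddle H f g h = jacobiRight H f g h

/-- A local bi-Poisson structure: all linear combinations `a H₀ + b H₁` with `a, b ∈ F` are Poisson
structures (in particular `H₀` and `H₁` are). -/
def IsBiPoisson (H₀ H₁ : Matrix (Fin ℓ) (Fin ℓ) (DiffOp (DiffPoly F ℓ))) : Prop :=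
  ∀ a b : F, IsPoisson (DiffOp.const (MvPolynomial.C a : DiffPoly F ℓ) • H₀ +
    DiffOp.const (MvPolynomial.C b : DiffPoly F ℓ) • H₁)

/-- `θ` is central for the `λ`-bracket of `H`. -/
def IsCentral (H : Matrix (Fin ℓ) (Fin ℓ) (DiffOp (DiffPoly F ℓ))) (θ : DiffPoly F ℓ) : Prop :=
  ∀ f : DiffPoly F ℓ, lamBracket H f θ = 0 ∧ lamBracket H θ f = 0

/-- A matrix pseudodifferential operator over `V`, regarded over the field of fractions `K`. -/
def overFrac (H : Matrix (Fin ℓ) (Fin ℓ) (PsDO (DiffPoly F ℓ))) :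
    Matrix (Fin ℓ) (Fin ℓ) (PsDO (FractionRing (DiffPoly F ℓ))) :=
  H.map (PsDO.map (algebraMap _ _))

/-- A matrix differential operator is nondegenerate if it is invertible in
`Mat_{ℓ×ℓ} K((∂⁻¹))`. -/
def IsNondegenerate (B : Matrix (Fin ℓ) (Fin ℓ) (DiffOp (DiffPoly F ℓ))) : Prop :=
  IsUnit (overFrac (toPsDO B))

/-- `H = A B⁻¹` with `A`, `B` matrix differential operators over `V` and `B` nondegenerate. -/
def IsFractionalDecomposition (H : Matrix (Fin ℓ) (Fin ℓ) (PsDO (DiffPoly F ℓ)))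
    (A B : Matrix (Fin ℓ) (Fin ℓ) (DiffOp (DiffPoly F ℓ))) : Prop :=
  IsNondegenerate B ∧ overFrac H = overFrac (toPsDO A) * Ring.inverse (overFrac (toPsDO B))

/-- The association relation between `ξ` and `P` defined by `H`: there are a fractional decomposition
`H = A B⁻¹` over `V` and a vector `f ∈ K^ℓ` such that `ξ = B f` and `P = A f`. -/
def IsAssociated (H : Matrix (Fin ℓ) (Fin ℓ) (PsDO (DiffPoly F ℓ))) (ξ P : Fin ℓ → DiffPoly F ℓ) :
    Prop :=
  ∃ A B, IsFractionalDecomposition H A B ∧ ∃ f : Fin ℓ → FractionRing (DiffPoly F ℓ),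
    (fun i => algebraMap _ (FractionRing (DiffPoly F ℓ)) (ξ i)) = matAct (algebraMap _ _) B f ∧
    (fun i => algebraMap _ (FractionRing (DiffPoly F ℓ)) (P i)) = matAct (algebraMap _ _) A f

/-- The Lenard-Magri recursive relations for `(H₀, H₁)`, the local functionals with densities `hₙ`,
`n ≥ -1` (the values `hₙ` for `n < -1` play no role), and the flows `Pₙ`, `n ≥ 0`. -/
def LenardMagri (H₀ H₁ : Matrix (Fin ℓ) (Fin ℓ) (PsDO (DiffPoly F ℓ))) (h : ℤ → DiffPoly F ℓ)
    (P : ℕ → Fin ℓ → DiffPoly F ℓ) : Prop :=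
  ∀ n : ℕ, IsAssociated H₁ (variationalDerivative (h (n - 1))) (P n) ∧
    IsAssociated H₀ (variationalDerivative (h n)) (P n)

/-- `B = H ∘ D_θ*`. -/
def diracB (H : Matrix (Fin ℓ) (Fin ℓ) (DiffOp (DiffPoly F ℓ))) (θ : Fin m → DiffPoly F ℓ) :
    Matrix (Fin ℓ) (Fin m) (DiffOp (DiffPoly F ℓ)) :=
  H * matAdjoint (frechet θ)

/-- `C = D_θ ∘ H ∘ D_θ*`. -/
def diracC (H : Matrix (Fin ℓ) (Fin ℓ) (DiffOp (DiffPoly F ℓ))) (θ : Fin m → DiffPoly F ℓ) :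
    Matrix (Fin m) (Fin m) (DiffOp (DiffPoly F ℓ)) :=
  frechet θ * H * matAdjoint (frechet θ)

/-- The Dirac modification `H^D = H + B C⁻¹ B*` by the constraints `θ`, meaningful when `C` is
invertible in `Mat_{m×m} V((∂⁻¹))`. -/
def diracModification (H : Matrix (Fin ℓ) (Fin ℓ) (DiffOp (DiffPoly F ℓ)))
    (θ : Fin m → DiffPoly F ℓ) : Matrix (Fin ℓ) (Fin ℓ) (PsDO (DiffPoly F ℓ)) :=
  toPsDO H + toPsDO (diracB H θ) * Ring.inverse (toPsDO (diracC H θ)) *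
    toPsDO (matAdjoint (diracB H θ))

end DifferentialPolynomials

end DiracReduction

end

noncomputable section

namespace DiracReduction

/-! ### Pseudodifferential and differential operators: adjoints, change of coefficients, action on
functions. -/

section Operators

variable {R : Type*} [CommRing R] [Differential R]

/-! Only the `H₁` relation changes. Write `ξ = δh_{n-1}/δu`. For a local operator association is
application, so `P_n = H₁ ξ` and `P_n = H₀ (δh_n/δu)`. Testing centrality of `θ` against the
variables `u_i` gives `D_θ ∘ H₀ = 0`, hence `D_θ P_n = 0`. As `H₁` is skewadjoint, `B* ξ = -D_θ H₁ ξ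
= -D_θ P_n = 0`.

It remains to find a fractional decomposition of `H₁^D` that realizes the association at such a `ξ`.
If `C⁻¹ B* = M N⁻¹`, then `H₁^D = (H₁ N + B M) N⁻¹`, and it suffices to have `F` with `N F = ξ` and
`M F = 0`, for then `(H₁ N + B M) F = H₁ ξ = P_n`.

Such `N`, `M`, `F` come from the kernel condition. The ring `K[∂]` is Euclidean, and an operator
injective on a linearly closed field is a unit; so the column of blocks `B`, `C`, having no kernel,
row-reduces to distinct standard basis vectors (`exists_unit_mul_eq`). Taking adjoints, and using
`C* = -C`, the row `(B* -C)` is the top of an invertible matrix with lower rows `(X Y)` and inverse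
with rows `(Q N)`, `(T M)` (`exists_complement`). The block identities give `B* N = C M`, `N X = 1 -
Q B*` and `M X = -T B*`, so `F = X ξ` works; they also show that `N` is invertible over `K((∂⁻¹))`,
with inverse `X + Y C⁻¹ B*`. Multiplying `N` and `M` on the right by a common denominator moves them
to `V[∂]` without changing the fraction (`isAssociated_diracModification`). -/

theorem derivPow_one_eq_deriv (x : R) : derivPow 1 x = x′ := by
  rw [← zero_add 1, derivPow_succ, derivPow_zero]

namespace PsDO

theorem coeff_single_zero_mul (r : R) (b : PsDO R) (k : ℤ) :
    (single 0 r * b).coeff k = r * b.coeff k := by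
  rw [coeff_mul, finsum_eq_single _ (0, 0)]
  · simp [mulTerm, coeff_single, derivPow_zero]
  · rintro ⟨m, j⟩ h
    by_cases hm : m = 0
    · subst hm
      have hj : j ≠ 0 := by rintro rfl; exact h rfl
      simp [mulTerm, Ring.choose_zero_pos ℤ (Nat.pos_of_ne_zero hj)]
    · simp [mulTerm, coeff_single, hm]

theorem coeff_mul_single_one (b : PsDO R) (k : ℤ) :
    (b * single 1 1).coeff k = b.coeff (k - 1) := by
  rw [coeff_mul, finsum_eq_single _ (k - 1, 0)]
  · simp [mulTerm, coeff_single, derivPow_zero]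
  · rintro ⟨m, j⟩ h
    simp only [mulTerm, coeff_single]
    split_ifs with h1
    · have hj : j ≠ 0 := by
        rintro rfl
        apply h
        have : m = k - 1 := by push_cast at h1; omega
        rw [this]
      simp [derivPow_one_eq_zero j hj]
    · simp

theorem coeff_single_one_mul (b : PsDO R) (k : ℤ) :
    (single 1 1 * b).coeff k = b.coeff (k - 1) + (b.coeff k)′ := by
  -- Only `j = 0, 1` survive, because `Ring.choose 1 j = 0` for `j > 1`.
  rw [coeff_mul, finsum_eq_sum_of_support_subset (s := {(1, 0), (1, 1)}),
    Finset.sum_pair (by simp)]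
  · simp [mulTerm, coeff_single, derivPow_zero, derivPow_one_eq_deriv]
  · rintro ⟨m, j⟩ h
    have h1 := (mulTerm_ne_zero h).1
    rw [coeff_single] at h1
    obtain rfl : m = 1 := by
      by_contra h2
      exact h1 (if_neg h2)
    have h2 : ¬ 1 < j := fun h2 => h (by
      rw [mulTerm, choose_eq_zero_of_lt (by simp) (by simpa using h2), Int.cast_zero, zero_mul])
    have : j = 0 ∨ j = 1 := by omega
    rcases this with rfl | rfl <;> simp

theorem adjointTerm_finite (a : PsDO R) (k : ℤ) (c : ℕ → ℤ) :
    (fun j : ℕ => (c j : R) * derivPow j (a.coeff (k + j))).HasFiniteSupport := by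
  obtain ⟨A, hA⟩ := a.exists_bound
  refine (Set.finite_Iic (A - k).toNat).subset fun j hj => ?_
  have : a.coeff (k + j) ≠ 0 := by
    intro h0
    exact hj (by simp [h0])
  have := hA _ this
  simp only [Set.mem_Iic]
  omega

theorem adjoint_add (a b : PsDO R) : (a + b).adjoint = a.adjoint + b.adjoint := by
  ext k
  rw [coeff_add]
  simp only [coeff_adjoint]
  rw [← finsum_add_distrib (adjointTerm_finite a k _) (adjointTerm_finite b k _)]
  exact finsum_congr fun j => by rw [coeff_add, map_add, mul_add]

theorem adjoint_single_zero (r : R) : (single 0 r).adjoint = single 0 r := by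
  ext k
  rw [coeff_adjoint]
  simp only [coeff_single]
  by_cases hk : k = 0
  · subst hk
    rw [finsum_eq_single _ 0]
    · simp [derivPow_zero]
    · intro j hj
      simp [hj]
  · rw [if_neg hk]
    refine (finsum_congr fun j => ?_).trans (finsum_zero (α := ℕ))
    split_ifs with h
    · have hj : 0 < j := by omega
      rw [h, Ring.choose_zero_pos ℤ hj]
      simp
    · simp

/-- Pascal's rule for `Ring.choose`, together with the sign change of `negOnePow` under a shift by
one. This is the case from which antimultiplicativity of the adjoint on differential operators is
built. -/
theorem adjoint_mul_single_one (a : PsDO R) :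
    (a * single 1 1).adjoint = -(single 1 1 * a.adjoint) := by
  ext k
  rw [coeff_neg, coeff_single_one_mul, coeff_adjoint]
  simp only [coeff_mul_single_one]
  obtain ⟨A, hA⟩ := a.exists_bound
  have hsum : ∀ (i : ℤ) (c : ℕ → ℤ) (M : ℕ), A - i < M →
      ∑ᶠ j : ℕ, (c j : R) * derivPow j (a.coeff (i + j)) =
        ∑ j ∈ Finset.range M, (c j : R) * derivPow j (a.coeff (i + j)) := by
    intro i c M hM
    refine finsum_eq_sum_of_support_subset _ fun j hj => ?_
    have : a.coeff (i + j) ≠ 0 := by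
      intro h0
      exact hj (by simp [h0])
    have := hA _ this
    simp only [Finset.coe_range, Set.mem_Iio]
    omega
  -- The two sums over `a.coeff (k - 1 + j)` are cut at `M + 1`, the sum over `a.coeff (k + j)` at
  -- `M`; once the terms `j = 0` are split off, all three run over `range M` with matching
  -- coefficients of `a`.
  have hM1 : A - (k - 1) < ((A - k + 2).toNat + 1 : ℕ) := by push_cast; omega
  have hM2 : A - k < (A - k + 2).toNat := by omega
  generalize (A - k + 2).toNat = M at hM1 hM2
  have h1 : ∀ j : ℕ, a.coeff (k + j - 1) = a.coeff ((k - 1) + j) := fun j => by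
    congr 1; ring
  simp only [h1]
  rw [coeff_adjoint, coeff_adjoint, hsum _ (fun j => ((k + j).negOnePow : ℤ) *
      Ring.choose (k + j) j) _ hM1, hsum _ (fun j => ((k - 1 + j).negOnePow : ℤ) *
      Ring.choose (k - 1 + j) j) _ hM1, hsum _ (fun j => ((k + j).negOnePow : ℤ) *
      Ring.choose (k + j) j) _ hM2, Finset.sum_range_succ', Finset.sum_range_succ', map_sum,
    add_right_comm, neg_add, ← Finset.sum_add_distrib, ← Finset.sum_neg_distrib]
  congr 1
  · refine Finset.sum_congr rfl fun j _ => ?_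
    have e1 : k + ((j + 1 : ℕ) : ℤ) = (k + j) + 1 := by push_cast; ring
    have e2 : k - 1 + ((j + 1 : ℕ) : ℤ) = k + j := by push_cast; ring
    rw [e2, e1, Ring.choose_succ_succ, Int.negOnePow_succ, derivPow_succ]
    simp only [Derivation.leibniz, Derivation.map_intCast, smul_eq_mul, mul_zero, add_zero]
    push_cast
    ring
  · have e1 : k = (k - 1) + 1 := by ring
    simp only [Nat.cast_zero, add_zero, Ring.choose_zero_right]
    conv_lhs => rw [e1, Int.negOnePow_succ]
    simp

variable {S : Type*} [CommRing S] [Differential S]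

theorem coeff_map (φ : R →+* S) (a : PsDO R) (k : ℤ) : (a.map φ).coeff k = φ (a.coeff k) := rfl

theorem map_derivPow {φ : R →+* S} (hφ : ∀ x, φ x′ = (φ x)′) (n : ℕ) (x : R) :
    φ (derivPow n x) = derivPow n (φ x) := by
  induction n with
  | zero => rfl
  | succ n ih => rw [derivPow_succ, derivPow_succ, hφ, ih]

/-- Change of coefficients along a homomorphism of differential rings. -/
def mapHom (φ : R →+* S) (hφ : ∀ x, φ x′ = (φ x)′) : PsDO R →+* PsDO S where
  toFun := map φ
  map_one' := by
    ext k
    rw [coeff_map, coeff_one, coeff_one]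
    split_ifs <;> simp
  map_zero' := by
    ext k
    simp [coeff_map]
  map_add' a b := by
    ext k
    simp [coeff_map]
  map_mul' a b := by
    ext k
    have h1 : φ (∑ᶠ p, mulTerm a b k p) = ∑ᶠ p, φ (mulTerm a b k p) :=
      φ.toAddMonoidHom.map_finsum (mulTerm_finite a b k)
    rw [coeff_map, coeff_mul, coeff_mul, h1]
    refine finsum_congr fun p => ?_
    simp only [mulTerm, map_mul, map_intCast, coeff_map, map_derivPow hφ]

theorem map_adjoint {φ : R →+* S} (hφ : ∀ x, φ x′ = (φ x)′) (a : PsDO R) :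
    a.adjoint.map φ = (a.map φ).adjoint := by
  ext k
  have h1 : φ (∑ᶠ j : ℕ, (((k + j).negOnePow : ℤ) * Ring.choose (k + j) j : ℤ) *
      derivPow j (a.coeff (k + j))) = ∑ᶠ j : ℕ, φ ((((k + j).negOnePow : ℤ) *
      Ring.choose (k + j) j : ℤ) * derivPow j (a.coeff (k + j))) :=
    φ.toAddMonoidHom.map_finsum (adjointTerm_finite a k _)
  rw [coeff_map, coeff_adjoint, coeff_adjoint, h1]
  refine finsum_congr fun j => ?_
  simp only [map_mul, map_intCast, coeff_map, map_derivPow hφ]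

end PsDO

namespace DiffOp

theorem ext {a b : DiffOp R} (h : ∀ n, a.coeff n = b.coeff n) : a = b := by
  refine Subtype.ext (PsDO.ext fun k => ?_)
  by_cases hk : k < 0
  · rw [a.2 k hk, b.2 k hk]
  · obtain ⟨n, rfl⟩ := Int.eq_ofNat_of_zero_le (not_lt.1 hk)
    exact h n

/-- The operator `∂`. -/
def del : DiffOp R := ⟨PsDO.single 1 1, fun n hn => by rw [PsDO.coeff_single, if_neg (by omega)]⟩

theorem coeff_zero (n : ℕ) : (0 : DiffOp R).coeff n = 0 := rfl

theorem coeff_add (a b : DiffOp R) (n : ℕ) : (a + b).coeff n = a.coeff n + b.coeff n := rfl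

theorem coeff_sub (a b : DiffOp R) (n : ℕ) : (a - b).coeff n = a.coeff n - b.coeff n := by
  rw [sub_eq_add_neg, sub_eq_add_neg]; rfl

theorem coeff_const (r : R) (n : ℕ) : (const r).coeff n = if n = 0 then r else 0 := by
  simp [const, coeff, PsDO.coeff_single]

theorem coeff_const_mul (r : R) (a : DiffOp R) (n : ℕ) :
    (const r * a).coeff n = r * a.coeff n :=
  PsDO.coeff_single_zero_mul r a n

theorem coeff_mul_del_zero (a : DiffOp R) : (a * del).coeff 0 = 0 :=
  (PsDO.coeff_mul_single_one _ _).trans (a.2 _ (by simp))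

theorem coeff_mul_del_succ (a : DiffOp R) (n : ℕ) : (a * del).coeff (n + 1) = a.coeff n :=
  (PsDO.coeff_mul_single_one _ _).trans (by simp [coeff])

theorem coeff_del_mul_zero (a : DiffOp R) : (del * a).coeff 0 = (a.coeff 0)′ := by
  refine (PsDO.coeff_single_one_mul _ _).trans ?_
  rw [a.2 _ (by simp), zero_add]
  rfl

theorem coeff_del_mul_succ (a : DiffOp R) (n : ℕ) :
    (del * a).coeff (n + 1) = a.coeff n + (a.coeff (n + 1))′ := by
  refine (PsDO.coeff_single_one_mul _ _).trans ?_
  simp [coeff]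

theorem const_zero : const (0 : R) = 0 := ext fun n => by rw [coeff_const, coeff_zero, ite_self]

theorem const_one : const (1 : R) = 1 := rfl

theorem const_mul (r s : R) : const (r * s) = const r * const s :=
  ext fun n => by simp only [coeff_const_mul, coeff_const]; split_ifs <;> simp

theorem del_mul_const (r : R) : del * const r = const r * del + const r′ := by
  refine ext fun n => ?_
  rcases n with _ | n
  · rw [coeff_add, coeff_mul_del_zero, coeff_del_mul_zero]
    simp [coeff_const]
  · rw [coeff_add, coeff_mul_del_succ, coeff_del_mul_succ]
    simp [coeff_const]

theorem exists_coeff_bound (a : DiffOp R) : ∃ N : ℕ, ∀ n, N ≤ n → a.coeff n = 0 := by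
  obtain ⟨A, hA⟩ := (a : PsDO R).exists_bound
  refine ⟨(A + 1).toNat, fun n hn => ?_⟩
  by_contra h
  have := hA n h
  omega

-- Every operator is `a₀ + b ∂` with `b` of smaller order, so identities in `R[∂]` need checking
-- only on multiplications, sums and right multiplication by `∂`.
@[elab_as_elim]
theorem induction {p : DiffOp R → Prop} (const : ∀ r, p (const r))
    (add : ∀ a b, p a → p b → p (a + b)) (mul_del : ∀ a, p a → p (a * del)) (a : DiffOp R) :
    p a := by
  obtain ⟨N, hN⟩ := a.exists_coeff_bound
  induction N generalizing a with
  | zero =>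
    have : a = DiffOp.const 0 := ext fun n => by simp [hN n (Nat.zero_le n), coeff_const]
    exact this ▸ const 0
  | succ N ih =>
    let b : DiffOp R := ⟨⟨fun k => if 0 ≤ k then (a : PsDO R).coeff (k + 1) else 0, by
      obtain ⟨A, hA⟩ := (a : PsDO R).exists_bound
      refine ⟨A, fun k hk => ?_⟩
      dsimp only
      split_ifs
      · by_contra h
        have := hA _ h
        omega
      · rfl⟩, fun k hk => if_neg (not_le.2 hk)⟩
    have hb : ∀ n, b.coeff n = a.coeff (n + 1) := fun n => by
      change (if (0 : ℤ) ≤ n then (a : PsDO R).coeff (n + 1) else 0) = _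
      rw [if_pos (Int.natCast_nonneg n)]
      rfl
    have h : a = DiffOp.const (a.coeff 0) + b * del := by
      refine ext fun n => ?_
      rcases n with _ | n
      · rw [coeff_add, coeff_mul_del_zero]
        simp [coeff_const]
      · rw [coeff_add, coeff_mul_del_succ, hb]
        simp [coeff_const]
    rw [h]
    exact add _ _ (const _) (mul_del _ (ih b fun n hn => by rw [hb, hN _ (by omega)]))

theorem adjoint_add (a b : DiffOp R) : (a + b).adjoint = a.adjoint + b.adjoint :=
  Subtype.ext (PsDO.adjoint_add _ _)

theorem adjoint_const (r : R) : (const r).adjoint = const r :=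
  Subtype.ext (PsDO.adjoint_single_zero r)

theorem adjoint_mul_del (a : DiffOp R) : (a * del).adjoint = -(del * a.adjoint) :=
  Subtype.ext (PsDO.adjoint_mul_single_one _)

theorem adjoint_del : (del : DiffOp R).adjoint = -del := by
  rw [← one_mul del, adjoint_mul_del, ← const_one, adjoint_const, const_one, mul_one, one_mul]

theorem adjoint_mul (a b : DiffOp R) : (a * b).adjoint = b.adjoint * a.adjoint := by
  induction b using induction with
  | const r =>
    rw [adjoint_const]
    -- Moving `∂` past `r` produces `r′` as well, so the inner hypothesis is needed for all
    -- multipliers.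
    induction a using induction generalizing r with
    | const s => rw [← const_mul, adjoint_const, adjoint_const, ← const_mul, mul_comm]
    | add a b ha hb => rw [add_mul, adjoint_add, ha, hb, adjoint_add, mul_add]
    | mul_del a ha =>
      rw [mul_assoc, del_mul_const, mul_add, ← mul_assoc, adjoint_add, adjoint_mul_del, ha, ha,
        adjoint_mul_del, ← mul_assoc, del_mul_const]
      noncomm_ring
  | add b c hb hc => rw [mul_add, adjoint_add, hb, hc, adjoint_add, add_mul]
  | mul_del b hb => rw [← mul_assoc, adjoint_mul_del, hb, adjoint_mul_del, neg_mul, mul_assoc]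

theorem adjoint_neg (a : DiffOp R) : (-a).adjoint = -a.adjoint := by
  have h : (-a).adjoint + a.adjoint = 0 := by
    rw [← adjoint_add, neg_add_cancel, ← const_zero, adjoint_const]
  exact eq_neg_of_add_eq_zero_left h

theorem adjoint_adjoint (a : DiffOp R) : a.adjoint.adjoint = a := by
  induction a using induction with
  | const r => rw [adjoint_const, adjoint_const]
  | add a b ha hb => rw [adjoint_add, adjoint_add, ha, hb]
  | mul_del a ha => rw [adjoint_mul_del, adjoint_neg, adjoint_mul, ha, adjoint_del]; simp

variable {S : Type*} [CommRing S] [Differential S]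

theorem act_eq_sum (φ : R →+* S) {a : DiffOp R} {N : ℕ} (hN : ∀ n, N ≤ n → a.coeff n = 0) (f : S) :
    a.act φ f = ∑ n ∈ Finset.range N, φ (a.coeff n) * derivPow n f := by
  refine finsum_eq_sum_of_support_subset _ fun n hn => ?_
  by_contra h
  exact hn (by simp [hN n (by simpa using h)])

theorem add_act (φ : R →+* S) (a b : DiffOp R) (f : S) :
    (a + b).act φ f = a.act φ f + b.act φ f := by
  obtain ⟨A, hA⟩ := a.exists_coeff_bound
  obtain ⟨B, hB⟩ := b.exists_coeff_bound
  rw [act_eq_sum φ (N := max A B) (a := a) (fun n hn => hA n (by omega)),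
    act_eq_sum φ (N := max A B) (a := b) (fun n hn => hB n (by omega)),
    act_eq_sum φ (N := max A B) (fun n hn => by
      rw [coeff_add, hA n (by omega), hB n (by omega), add_zero]), ← Finset.sum_add_distrib]
  exact Finset.sum_congr rfl fun n _ => by rw [coeff_add, map_add, add_mul]

theorem act_add (φ : R →+* S) (a : DiffOp R) (f g : S) :
    a.act φ (f + g) = a.act φ f + a.act φ g := by
  obtain ⟨A, hA⟩ := a.exists_coeff_bound
  simp only [act_eq_sum φ hA, map_add, mul_add, Finset.sum_add_distrib]

theorem act_zero (φ : R →+* S) (a : DiffOp R) : a.act φ 0 = 0 := by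
  obtain ⟨A, hA⟩ := a.exists_coeff_bound
  simp [act_eq_sum φ hA]

theorem const_act (φ : R →+* S) (r : R) (f : S) : (const r).act φ f = φ r * f := by
  rw [act_eq_sum φ (N := 1) (fun n hn => by rw [coeff_const, if_neg (by omega)])]
  simp [coeff_const, derivPow_zero]

theorem zero_act (φ : R →+* S) (f : S) : (0 : DiffOp R).act φ f = 0 := by
  rw [← const_zero, const_act, map_zero, zero_mul]

theorem one_act (φ : R →+* S) (f : S) : (1 : DiffOp R).act φ f = f := by
  rw [← const_one, const_act, map_one, one_mul]

theorem mul_del_act (φ : R →+* S) (a : DiffOp R) (f : S) : (a * del).act φ f = a.act φ f′ := by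
  obtain ⟨A, hA⟩ := a.exists_coeff_bound
  rw [act_eq_sum φ hA, act_eq_sum φ (N := A + 1), Finset.sum_range_succ', coeff_mul_del_zero]
  · simp only [coeff_mul_del_succ, derivPow_add, derivPow_one_eq_deriv, map_zero, zero_mul,
      add_zero]
  · rintro (_ | n) hn
    · omega
    · rw [coeff_mul_del_succ, hA _ (by omega)]

theorem del_mul_act {φ : R →+* S} (hφ : ∀ x, φ x′ = (φ x)′) (a : DiffOp R) (f : S) :
    (del * a).act φ f = (a.act φ f)′ := by
  induction a using induction generalizing f with
  | const r =>
    rw [del_mul_const, add_act, mul_del_act, const_act, const_act, const_act, hφ]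
    simp
    ring
  | add a b ha hb => rw [mul_add, add_act, ha, hb, add_act, map_add]
  | mul_del a ha => rw [← mul_assoc, mul_del_act, ha, mul_del_act]

theorem mul_act {φ : R →+* S} (hφ : ∀ x, φ x′ = (φ x)′) (a b : DiffOp R) (f : S) :
    (a * b).act φ f = a.act φ (b.act φ f) := by
  induction a using induction generalizing b with
  | const r =>
    obtain ⟨B, hB⟩ := b.exists_coeff_bound
    rw [const_act, act_eq_sum φ hB, act_eq_sum φ (N := B), Finset.mul_sum]
    · exact Finset.sum_congr rfl fun n _ => by rw [coeff_const_mul, map_mul, mul_assoc]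
    · intro n hn
      rw [coeff_const_mul, hB n hn, mul_zero]
  | add a c ha hc => rw [add_mul, add_act, ha, hc, add_act]
  | mul_del a ha => rw [mul_assoc, ha, del_mul_act hφ, mul_del_act]

/-- Change of coefficients along a homomorphism of differential rings. -/
def mapHom (φ : R →+* S) (hφ : ∀ x, φ x′ = (φ x)′) : DiffOp R →+* DiffOp S :=
  ((PsDO.mapHom φ hφ).comp (diffOps R).subtype).codRestrict (diffOps S) fun a n hn => by
    exact (congrArg φ (a.2 n hn)).trans (map_zero φ)

theorem coeff_mapHom (φ : R →+* S) (hφ : ∀ x, φ x′ = (φ x)′) (a : DiffOp R) (n : ℕ) :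
    (mapHom φ hφ a).coeff n = φ (a.coeff n) := rfl

theorem mapHom_const (φ : R →+* S) (hφ : ∀ x, φ x′ = (φ x)′) (r : R) :
    mapHom φ hφ (const r) = const (φ r) :=
  ext fun n => by rw [coeff_mapHom, coeff_const, coeff_const]; split_ifs <;> simp

theorem mapHom_del (φ : R →+* S) (hφ : ∀ x, φ x′ = (φ x)′) : mapHom φ hφ del = del := by
  refine Subtype.ext (PsDO.ext fun n => ?_)
  change φ ((PsDO.single 1 1).coeff n) = (PsDO.single 1 1).coeff n
  rw [PsDO.coeff_single, PsDO.coeff_single]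
  split_ifs <;> simp

theorem mapHom_adjoint (φ : R →+* S) (hφ : ∀ x, φ x′ = (φ x)′) (a : DiffOp R) :
    mapHom φ hφ a.adjoint = (mapHom φ hφ a).adjoint :=
  Subtype.ext (PsDO.map_adjoint hφ _)

theorem mapHom_injective (φ : R →+* S) (hφ : ∀ x, φ x′ = (φ x)′) (h : Function.Injective φ) :
    Function.Injective (mapHom φ hφ) := fun a b hab => ext fun n => h (by
  rw [← coeff_mapHom φ hφ, hab, coeff_mapHom])

end DiffOp

end Operators

/-! ### Row reduction over a noncommutative Euclidean ring. -/

section RowReduction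

open Matrix

variable {Λ : Type*} [Ring Λ] {ι : Type*} [Fintype ι] [DecidableEq ι]

/-- The matrix of `u ↦ u + a uᵢ`. -/
def columnOp (i : ι) (a : ι → Λ) : Matrix ι ι Λ :=
  1 + Matrix.of fun k j => if j = i then a k else 0

theorem columnOp_mulVec (i : ι) (a u : ι → Λ) (k : ι) :
    (columnOp i a *ᵥ u) k = u k + a k * u i := by
  rw [columnOp, add_mulVec, one_mulVec, Pi.add_apply]
  congr 1
  simp [mulVec, dotProduct, ite_mul]

theorem eq_one_of_mulVec {A : Matrix ι ι Λ} (h : ∀ u, A *ᵥ u = u) : A = 1 := by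
  ext i j
  have := congrFun (h (Pi.single j 1)) i
  simpa [mulVec_single, Matrix.one_apply, Pi.single_apply] using this

/-- The matrix of `u ↦ u + a uᵢ` is invertible if `1 + aᵢ` is. -/
def columnUnit (i : ι) (a : ι → Λ) (g : Λˣ) (hg : (g : Λ) = 1 + a i) : (Matrix ι ι Λ)ˣ where
  val := columnOp i a
  -- If `w = u + a uᵢ`, then `wᵢ = g uᵢ`, hence `u = w - a g⁻¹ wᵢ`.
  inv := columnOp i fun k => -(a k * (g⁻¹ : Λˣ))
  val_inv := eq_one_of_mulVec fun u => by
    have h : 1 - a i * ((g⁻¹ : Λˣ) : Λ) = (g⁻¹ : Λˣ) := by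
      rw [eq_sub_of_add_eq' hg.symm, sub_mul, g.mul_inv]
      simp
    ext k
    rw [← mulVec_mulVec, columnOp_mulVec, columnOp_mulVec, columnOp_mulVec]
    have h2 : u i + -(a i * ((g⁻¹ : Λˣ) : Λ)) * u i = (g⁻¹ : Λˣ) * u i := by
      rw [← congrArg (· * u i) h]
      simp only [add_mul, neg_mul, one_mul, sub_eq_add_neg]
    rw [h2]
    noncomm_ring
  inv_val := eq_one_of_mulVec fun u => by
    ext k
    rw [← mulVec_mulVec, columnOp_mulVec, columnOp_mulVec, columnOp_mulVec]
    have h2 : u i + a i * u i = g * u i := by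
      rw [hg]; noncomm_ring
    rw [h2, neg_mul, mul_assoc, ← mul_assoc _ (g : Λ), g.inv_mul, one_mul]
    abel

theorem columnUnit_mulVec (i : ι) (a : ι → Λ) (g : Λˣ) (hg : (g : Λ) = 1 + a i) (u : ι → Λ)
    (k : ι) : ((columnUnit i a g hg).1 *ᵥ u) k = u k + a k * u i :=
  columnOp_mulVec i a u k

/-- The Euclidean algorithm on the entries of a column at the positions in `T`. -/
theorem exists_unit_clear (size : Λ → ℕ)
    (hsize : ∀ a b, a ≠ 0 → b ≠ 0 → size b ≤ size a → ∃ q, size (a - q * b) < size a)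
    (T : Finset ι) (hT : T.Nonempty) (v : ι → Λ) :
    ∃ W : (Matrix ι ι Λ)ˣ, (∀ u : ι → Λ, (∀ i ∈ T, u i = 0) → W.1 *ᵥ u = u) ∧
      ∃ i₀ ∈ T, ∀ i ∈ T, i ≠ i₀ → (W.1 *ᵥ v) i = 0 := by
  -- Each division step replaces one entry by a smaller remainder and so lowers the total size on
  -- `T`.
  induction hn : ∑ i ∈ T, size (v i) using Nat.strong_induction_on generalizing v with
  | _ n ih =>
    subst hn
    by_cases h : ∃ i ∈ T, ∃ j ∈ T, i ≠ j ∧ v i ≠ 0 ∧ v j ≠ 0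
    · obtain ⟨i, hi, j, hj, hij, hvi, hvj, hle⟩ : ∃ i ∈ T, ∃ j ∈ T, i ≠ j ∧ v i ≠ 0 ∧ v j ≠ 0 ∧
          size (v j) ≤ size (v i) := by
        obtain ⟨i, hi, j, hj, hij, hvi, hvj⟩ := h
        rcases le_total (size (v j)) (size (v i)) with hle | hle
        · exact ⟨i, hi, j, hj, hij, hvi, hvj, hle⟩
        · exact ⟨j, hj, i, hi, hij.symm, hvj, hvi, hle⟩
      obtain ⟨q, hq⟩ := hsize _ _ hvi hvj hle
      let U := columnUnit j (Pi.single i (-q)) 1 (by simp [hij.symm])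
      have hU : ∀ u k, (U.1 *ᵥ u) k = u k + (Pi.single i (-q) : ι → Λ) k * u j :=
        columnUnit_mulVec j _ _ _
      have hi' : (U.1 *ᵥ v) i = v i - q * v j := by
        rw [hU, Pi.single_eq_same, neg_mul, sub_eq_add_neg]
      have hk' : ∀ k, k ≠ i → (U.1 *ᵥ v) k = v k := fun k hk => by
        rw [hU, Pi.single_eq_of_ne hk, zero_mul, add_zero]
      have hlt : ∑ k ∈ T, size ((U.1 *ᵥ v) k) < ∑ k ∈ T, size (v k) := by
        refine Finset.sum_lt_sum (fun k _ => ?_) ⟨i, hi, by rw [hi']; exact hq⟩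
        by_cases hk : k = i
        · rw [hk, hi']; exact hq.le
        · rw [hk' k hk]
      obtain ⟨W, hW, i₀, hi₀, hW₀⟩ := ih _ hlt (U.1 *ᵥ v) rfl
      refine ⟨W * U, fun u hu => ?_, i₀, hi₀, fun k hk hk₀ => ?_⟩
      · rw [Units.val_mul, ← mulVec_mulVec]
        have : U.1 *ᵥ u = u := funext fun k => by rw [hU, hu j hj, mul_zero, add_zero]
        rw [this, hW u hu]
      · rw [Units.val_mul, ← mulVec_mulVec, hW₀ k hk hk₀]
    · push Not at h
      refine ⟨1, fun u _ => by simp, ?_⟩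
      -- At most one entry on `T` is still nonzero. It is the pivot; if there is none, any position
      -- in `T` serves.
      by_cases h0 : ∃ i ∈ T, v i ≠ 0
      · obtain ⟨i, hi, hvi⟩ := h0
        refine ⟨i, hi, fun k hk hki => ?_⟩
        simpa using h i hi k hk hki.symm hvi
      · push Not at h0
        obtain ⟨i, hi⟩ := hT
        exact ⟨i, hi, fun k hk _ => by simpa using h0 k hk⟩

/-- A matrix with trivial kernel on `M` is reduced by invertible row operations to one whose columns
are distinct standard basis vectors, if `Λ` is Euclidean and the elements of `Λ` that are injective
on `M` are units. -/
theorem exists_unit_mul_eq {M : Type*} [AddCommGroup M] [Module Λ M] (size : Λ → ℕ)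
    (hsize : ∀ a b, a ≠ 0 → b ≠ 0 → size b ≤ size a → ∃ q, size (a - q * b) < size a)
    (hunit : ∀ g : Λ, (∀ u : M, g • u = 0 → u = 0) → IsUnit g) {m : ℕ}
    (hm : m ≤ Fintype.card ι) (A : Matrix ι (Fin m) Λ)
    (hA : ∀ f : Fin m → M, (∀ i, ∑ j, A i j • f j = 0) → f = 0) :
    ∃ (W : (Matrix ι ι Λ)ˣ) (e : Fin m → ι), Function.Injective e ∧
      ∀ i j, (W.1 * A) i j = if i = e j then 1 else 0 := by
  -- The columns are treated one at a time; only the values of `e` on the first `k` columns carry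
  -- information.
  suffices key : ∀ k : ℕ, k ≤ m → ∃ (W : (Matrix ι ι Λ)ˣ) (e : Fin m → ι),
      (∀ j j' : Fin m, j < k → j' < k → e j = e j' → j = j') ∧
      ∀ j : Fin m, j < k → ∀ i, (W.1 * A) i j = if i = e j then 1 else 0 by
    obtain ⟨W, e, h1, h2⟩ := key m le_rfl
    exact ⟨W, e, fun j j' h => h1 j j' j.2 j'.2 h, fun i j => h2 j j.2 i⟩
  intro k
  induction k with
  | zero =>
    intro _
    obtain ⟨e⟩ := Function.Embedding.nonempty_of_card_le (α := Fin m) (β := ι) (by simpa using hm)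
    exact ⟨1, e, fun j j' h => absurd h (Nat.not_lt_zero _), fun j h => absurd h (Nat.not_lt_zero _)⟩
  | succ k ih =>
    intro hk
    obtain ⟨W, e, he, hW⟩ := ih (by omega)
    let κ : Fin m := ⟨k, hk⟩
    let S : Finset ι := (Finset.univ.filter fun j : Fin m => (j : ℕ) < k).image e
    have hS : ∀ i, i ∈ S ↔ ∃ j : Fin m, (j : ℕ) < k ∧ e j = i := fun i => by simp [S]
    have hT : Sᶜ.Nonempty := by
      rw [← Finset.card_pos, Finset.card_compl]
      have h1 : S.card ≤ (Finset.univ.filter fun j : Fin m => (j : ℕ) < k).card :=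
        Finset.card_image_le
      have h2 : (Finset.univ.filter fun j : Fin m => (j : ℕ) < k).card ≤ (Finset.range k).card :=
        Finset.card_le_card_of_injOn (fun j => (j : ℕ)) (fun j hj => by simpa using hj)
          (fun _ _ _ _ h => Fin.ext h)
      rw [Finset.card_range] at h2
      omega
    -- Operating only in the rows outside `S` keeps the finished columns, whose nonzero entries lie
    -- in `S`.
    obtain ⟨W₁, hfix, i₀, hi₀, hclear⟩ :=
      exists_unit_clear size hsize Sᶜ hT fun i => (W.1 * A) i κ
    have hi₀S : ∀ j : Fin m, (j : ℕ) < k → e j ≠ i₀ := fun j hj h =>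
      (Finset.mem_compl.1 hi₀) ((hS i₀).2 ⟨j, hj, h⟩)
    have hcol : ∀ (B : Matrix ι ι Λ) (C : Matrix ι (Fin m) Λ) i j,
        (B * C) i j = (B *ᵥ fun i => C i j) i := fun _ _ _ _ => rfl
    have hcols : ∀ j : Fin m, (j : ℕ) < k → ∀ i,
        (W₁.1 * (W.1 * A)) i j = if i = e j then 1 else 0 := by
      intro j hj i
      rw [hcol, hfix, hW j hj]
      intro i hi
      rw [hW j hj, if_neg]
      rintro rfl
      exact (Finset.mem_compl.1 hi) ((hS _).2 ⟨j, hj, rfl⟩)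
    set v : ι → Λ := fun i => (W₁.1 * (W.1 * A)) i κ with hv
    have hv0 : ∀ i, i ∉ S → i ≠ i₀ → v i = 0 := fun i hi h => hclear i (Finset.mem_compl.2 hi) h
    -- Invertible row operations do not change the kernel.
    have hker : ∀ f : Fin m → M, (∀ i, ∑ j, (W₁.1 * (W.1 * A)) i j • f j = 0) → f = 0 := by
      intro f hf
      refine hA f fun i => ?_
      have h1 : A = (W₁ * W)⁻¹.1 * (W₁.1 * (W.1 * A)) := by
        rw [← Matrix.mul_assoc W₁.1, ← Units.val_mul, ← Matrix.mul_assoc, ← Units.val_mul,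
          inv_mul_cancel, Units.val_one, Matrix.one_mul]
      rw [h1]
      generalize (W₁.1 * (W.1 * A)) = X at hf
      simp only [Matrix.mul_apply, Finset.sum_smul, mul_smul]
      rw [Finset.sum_comm]
      simp only [← Finset.smul_sum, hf, smul_zero, Finset.sum_const_zero]
    have hg : IsUnit (v i₀) := by
      refine hunit _ fun u hu => ?_
      -- If the pivot kills `u`, put `u` in the new column and let the finished columns cancel the
      -- entries of `v` in the rows of `S`. The resulting kernel vector must vanish, so `u = 0` and
      -- the pivot is a unit.
      let f : Fin m → M := fun j => if (j : ℕ) < k then -(v (e j) • u) else if j = κ then u else 0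
      have hf : f = 0 := by
        refine hker f fun i => ?_
        have h1 : ∀ j, (W₁.1 * (W.1 * A)) i j • f j =
            (if (j : ℕ) < k ∧ i = e j then -(v (e j) • u) else 0) +
              if j = κ then v i • u else 0 := by
          intro j
          by_cases hj : (j : ℕ) < k
          · have hjκ : j ≠ κ := fun h => by rw [h] at hj; exact lt_irrefl _ hj
            rw [hcols j hj]
            by_cases hi : i = e j <;> simp [f, hj, hjκ, hi]
          · by_cases hjκ : j = κ
            · subst hjκ
              simp [f, hj, hv]
            · simp [f, hj, hjκ]
        simp only [h1]
        rw [Finset.sum_add_distrib, Finset.sum_ite_eq' Finset.univ κ, if_pos (Finset.mem_univ _)]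
        by_cases hi : i ∈ S
        · obtain ⟨j, hj, rfl⟩ := (hS i).1 hi
          rw [Finset.sum_eq_single j]
          · simp [hj]
          · intro j' _ hj'
            exact if_neg fun h => hj' (he j j' hj h.1 h.2).symm
          · simp
        · rw [Finset.sum_eq_zero, zero_add]
          · by_cases h : i = i₀
            · rw [h, hu]
            · rw [hv0 i hi h, zero_smul]
          · intro j _
            exact if_neg fun h => hi ((hS i).2 ⟨j, h.1, h.2.symm⟩)
      simpa [f, κ] using congrFun hf κ
    obtain ⟨g, hg⟩ := hg
    -- Chosen so that `v + a g` is the basis vector at `i₀`; then `1 + a i₀ = g⁻¹` is a unit.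
    let a : ι → Λ := fun i => -((v i - (Pi.single i₀ 1 : ι → Λ) i) * (g⁻¹ : Λˣ))
    let W₂ := columnUnit i₀ a g⁻¹ (by simp [a, ← hg, sub_mul])
    have hW₂ : ∀ u k, (W₂.1 *ᵥ u) k = u k + a k * u i₀ := columnUnit_mulVec i₀ a _ _
    refine ⟨W₂ * (W₁ * W), Function.update e κ i₀, ?_, ?_⟩
    · intro j j' hj hj' h
      by_cases h1 : j = κ <;> by_cases h2 : j' = κ
      · rw [h1, h2]
      · have : (j' : ℕ) ≠ k := fun h => h2 (Fin.ext h)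
        rw [h1, Function.update_self, Function.update_of_ne h2] at h
        exact absurd h.symm (hi₀S j' (by omega))
      · have : (j : ℕ) ≠ k := fun h => h1 (Fin.ext h)
        rw [h2, Function.update_self, Function.update_of_ne h1] at h
        exact absurd h (hi₀S j (by omega))
      · have : (j' : ℕ) ≠ k := fun h => h2 (Fin.ext h)
        have : (j : ℕ) ≠ k := fun h => h1 (Fin.ext h)
        rw [Function.update_of_ne h1, Function.update_of_ne h2] at h
        exact he j j' (by omega) (by omega) h
    · intro j hj i
      rw [Units.val_mul, Units.val_mul, Matrix.mul_assoc, Matrix.mul_assoc, hcol, hW₂]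
      by_cases h1 : j = κ
      · rw [h1, Function.update_self]
        change v i + a i * v i₀ = _
        simp only [a]
        rw [← hg, neg_mul, mul_assoc, g.inv_mul, mul_one, Pi.single_apply]
        abel
      · have : (j : ℕ) ≠ k := fun h => h1 (Fin.ext h)
        have hj : (j : ℕ) < k := by omega
        rw [Function.update_of_ne h1, hcols j hj, hcols j hj, if_neg (hi₀S j hj).symm, mul_zero,
          add_zero]

end RowReduction

/-! ### Symbols, Euclidean division and common denominators for differential operators. -/

namespace DiffOp

section Symbol

variable {R : Type*} [CommRing R] [Differential R]

theorem coeff_const_mul_del_pow (r : R) (k n : ℕ) :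
    (const r * del ^ k).coeff n = if n = k then r else 0 := by
  induction k generalizing n with
  | zero => rw [pow_zero, mul_one, coeff_const]
  | succ k ih =>
    rw [pow_succ, ← mul_assoc]
    rcases n with _ | n
    · rw [coeff_mul_del_zero, if_neg (by omega)]
    · rw [coeff_mul_del_succ, ih]
      simp

/-- The coefficient of `∂ⁿ` as an additive homomorphism. -/
def coeffHom (n : ℕ) : DiffOp R →+ R where
  toFun a := a.coeff n
  map_zero' := coeff_zero n
  map_add' a b := coeff_add a b n

theorem coeff_sum {α : Type*} (s : Finset α) (f : α → DiffOp R) (n : ℕ) :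
    (∑ i ∈ s, f i).coeff n = ∑ i ∈ s, (f i).coeff n :=
  map_sum (coeffHom n) f s

theorem eq_sum {a : DiffOp R} {N : ℕ} (hN : ∀ n, N ≤ n → a.coeff n = 0) :
    a = ∑ k ∈ Finset.range N, const (a.coeff k) * del ^ k := by
  refine ext fun n => ?_
  simp only [coeff_sum, coeff_const_mul_del_pow, Finset.sum_ite_eq, Finset.mem_range]
  split_ifs with h
  · rfl
  · exact hN n (not_lt.1 h)

/-- The number of coefficients of a differential operator up to the leading one. -/
def size (a : DiffOp R) : ℕ := sInf {N | ∀ n, N ≤ n → a.coeff n = 0}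

theorem coeff_eq_zero_of_size_le (a : DiffOp R) (n : ℕ) (h : a.size ≤ n) : a.coeff n = 0 :=
  Nat.sInf_mem (s := {N | ∀ n, N ≤ n → a.coeff n = 0}) a.exists_coeff_bound n h

theorem size_le {a : DiffOp R} {N : ℕ} (hN : ∀ n, N ≤ n → a.coeff n = 0) : a.size ≤ N :=
  Nat.sInf_le hN

theorem exists_size_eq_succ {a : DiffOp R} (ha : a ≠ 0) :
    ∃ n, a.size = n + 1 ∧ a.coeff n ≠ 0 := by
  have h0 : a.size ≠ 0 := fun h => ha (ext fun n => by
    rw [a.coeff_eq_zero_of_size_le n (by omega), coeff_zero])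
  obtain ⟨n, hn⟩ := Nat.exists_eq_succ_of_ne_zero h0
  refine ⟨n, hn, fun h => ?_⟩
  have : a.size ≤ n := size_le fun k hk => by
    rcases hk.eq_or_lt with rfl | hk
    · exact h
    · exact a.coeff_eq_zero_of_size_le k (by omega)
  omega

theorem coeff_del_pow_mul {b : DiffOp R} {n : ℕ} (hb : ∀ i, n < i → b.coeff i = 0) (k : ℕ) :
    (∀ i, n + k < i → (del ^ k * b).coeff i = 0) ∧ (del ^ k * b).coeff (n + k) = b.coeff n := by
  induction k with
  | zero => simpa using hb
  | succ k ih =>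
    rw [pow_succ', mul_assoc]
    constructor
    · rintro (_ | i) hi
      · omega
      · rw [coeff_del_mul_succ, ih.1 _ (by omega), ih.1 _ (by omega), map_zero, add_zero]
    · rw [← add_assoc, coeff_del_mul_succ, ih.2, ih.1 _ (by omega), map_zero, add_zero]

theorem coeff_sum_monomial (a : DiffOp R) (n : ℕ) :
    (∑ k ∈ Finset.range a.size, Polynomial.monomial k (a.coeff k)).coeff n = a.coeff n := by
  simp only [Polynomial.finsetSum_coeff, Polynomial.coeff_monomial, Finset.sum_ite_eq',
    Finset.mem_range]
  split_ifs with h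
  · rfl
  · rw [coeff_eq_zero_of_size_le _ _ (not_lt.1 h)]

/-- The symbol `∑ₙ aₙ λⁿ` of a differential operator. -/
def symbol : DiffOp R →+ Polynomial R where
  toFun a := ∑ n ∈ Finset.range a.size, Polynomial.monomial n (a.coeff n)
  map_zero' := by simp [coeff_zero]
  map_add' a b := by
    ext n
    rw [Polynomial.coeff_add, coeff_sum_monomial, coeff_sum_monomial, coeff_sum_monomial, coeff_add]

theorem coeff_symbol (a : DiffOp R) (n : ℕ) : (symbol a).coeff n = a.coeff n :=
  coeff_sum_monomial a n

theorem symbol_injective : Function.Injective (symbol : DiffOp R →+ Polynomial R) :=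
  fun a b h => ext fun n => by rw [← coeff_symbol, h, coeff_symbol]

theorem C_mul_symbol (r : R) (a : DiffOp R) :
    Polynomial.C r * (symbol a) = (const r * a).symbol := by
  ext n
  rw [Polynomial.coeff_C_mul, coeff_symbol, coeff_symbol, coeff_const_mul]

theorem symbol_one : (1 : DiffOp R).symbol = 1 := by
  ext n
  rw [coeff_symbol, ← const_one, coeff_const, Polynomial.coeff_one]

end Symbol

section Euclidean

variable {K : Type*} [Field K] [Differential K]

/-- Composing with `∂ᵏ` on the left keeps the leading coefficient of `b`, so over a field a left
multiple of `b` cancels the leading term of `a`. -/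
theorem exists_size_sub_mul_lt (a b : DiffOp K) (ha : a ≠ 0) (hb : b ≠ 0)
    (h : b.size ≤ a.size) : ∃ q, (a - q * b).size < a.size := by
  obtain ⟨n, hn, han⟩ := exists_size_eq_succ ha
  obtain ⟨m, hm, hbm⟩ := exists_size_eq_succ hb
  obtain ⟨k, rfl⟩ := Nat.exists_eq_add_of_le (show m ≤ n by omega)
  have hk := coeff_del_pow_mul (b := b) (n := m)
    (fun i hi => b.coeff_eq_zero_of_size_le i (by omega)) k
  refine ⟨const (a.coeff (m + k) / b.coeff m) * del ^ k, ?_⟩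
  rw [hn, Nat.lt_succ_iff]
  refine size_le fun i hi => ?_
  rw [coeff_sub, mul_assoc, coeff_const_mul]
  rcases hi.eq_or_lt with rfl | hi
  · rw [hk.2, div_mul_cancel₀ _ hbm, sub_self]
  · rw [hk.1 i hi, a.coeff_eq_zero_of_size_le i (by omega), mul_zero, sub_zero]

theorem isUnit_const {c : K} (hc : c ≠ 0) : IsUnit (const c) :=
  ⟨⟨const c, const c⁻¹, by rw [← const_mul, mul_inv_cancel₀ hc, const_one],
    by rw [← const_mul, inv_mul_cancel₀ hc, const_one]⟩, rfl⟩

/-- In a linearly closed field an operator of positive order kills some nonzero element. An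
injective operator thus has order zero and is multiplication by a nonzero scalar. -/
theorem isUnit_of_act_injective {L : Type*} [Field L] [Differential L] (φ : K →+* L)
    (hL : IsLinearlyClosed (⊤ : Subfield L)) (g : DiffOp K)
    (hg : ∀ u : L, g.act φ u = 0 → u = 0) : IsUnit g := by
  have h0 : g ≠ 0 := by
    rintro rfl
    exact one_ne_zero (hg 1 (zero_act φ 1))
  obtain ⟨n, hn, hgn⟩ := exists_size_eq_succ h0
  have hbound : ∀ i, n + 1 ≤ i → g.coeff i = 0 := fun i hi =>
    g.coeff_eq_zero_of_size_le i (by omega)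
  rcases Nat.eq_zero_or_pos n with rfl | hpos
  · have : g = const (g.coeff 0) := ext fun i => by
      rw [coeff_const]
      split_ifs with hi
      · rw [hi]
      · exact hbound i (by omega)
    rw [this]
    exact isUnit_const hgn
  · obtain ⟨u, -, hu, hsum⟩ := (hL n (fun i => φ (g.coeff i)) (fun _ => trivial)
      ((map_ne_zero φ).2 hgn)).2 hpos
    exact absurd (hg u ((act_eq_sum φ hbound u).trans hsum)) hu

end Euclidean

section Denominators

variable {A : Type*} [CommRing A] [IsDomain A] [Differential A]

theorem algebraMap_deriv (x : A) :
    algebraMap A (FractionRing A) x′ = (algebraMap A (FractionRing A) x)′ :=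
  (DifferentialAlgebra.deriv_algebraMap x).symm

variable (A) in
/-- A differential operator over a domain, regarded over the field of fractions. -/
def toFrac : DiffOp A →+* DiffOp (FractionRing A) :=
  mapHom (algebraMap A (FractionRing A)) algebraMap_deriv

theorem toFrac_injective : Function.Injective (toFrac A) :=
  mapHom_injective _ _ (IsFractionRing.injective A (FractionRing A))

/-- Denominators are cleared on the right because a common right factor of numerator and denominator
cancels in a fraction `A B⁻¹`. -/
theorem exists_mul_const_mem_range (a : DiffOp (FractionRing A)) :
    ∃ s : A, s ≠ 0 ∧ a * const (algebraMap A (FractionRing A) s) ∈ (toFrac A).range := by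
  induction a using induction with
  | const r =>
    obtain ⟨x, s, hs, rfl⟩ := IsFractionRing.div_surjective (A := A) r
    refine ⟨s, nonZeroDivisors.ne_zero hs, const x, ?_⟩
    have : algebraMap A (FractionRing A) s ≠ 0 :=
      (map_ne_zero_iff _ (IsFractionRing.injective A (FractionRing A))).2
        (nonZeroDivisors.ne_zero hs)
    rw [← const_mul, div_mul_cancel₀ _ this]
    exact mapHom_const _ _ _
  | add a b ha hb =>
    obtain ⟨s, hs, has⟩ := ha
    obtain ⟨t, ht, hbt⟩ := hb
    refine ⟨s * t, mul_ne_zero hs ht, ?_⟩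
    rw [add_mul, map_mul]
    refine add_mem ?_ ?_
    · rw [const_mul, ← mul_assoc]
      exact mul_mem has ⟨const t, mapHom_const _ _ _⟩
    · rw [mul_comm, const_mul, ← mul_assoc]
      exact mul_mem hbt ⟨const s, mapHom_const _ _ _⟩
  | mul_del a ha =>
    obtain ⟨s, hs, has⟩ := ha
    -- Squaring leaves a factor `s` for `a` after differentiation: `∂ ∘ s² = s ∘ (s ∂ + 2 s′)`.
    refine ⟨s * s, mul_ne_zero hs hs, ?_⟩
    have h : a * del * const (algebraMap A (FractionRing A) (s * s)) =
        a * const (algebraMap A (FractionRing A) s) *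
          toFrac A (const s * del + const (s′ + s′)) := by
      have h1 : toFrac A (const s * del + const (s′ + s′)) =
          const (algebraMap A (FractionRing A) s) * del +
            const (algebraMap A (FractionRing A) (s′ + s′)) := by
        rw [map_add, map_mul]
        simp only [toFrac, mapHom_const, mapHom_del]
      rw [h1, mul_assoc, del_mul_const, mul_assoc a]
      congr 1
      rw [mul_add, ← mul_assoc, ← const_mul, ← const_mul, ← map_mul, ← map_mul,
        ← algebraMap_deriv, Derivation.leibniz, smul_eq_mul, ← mul_add]
    rw [h]
    exact mul_mem has ⟨_, rfl⟩

theorem exists_forall_mul_const_mem_range {α : Type*} [Fintype α]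
    (a : α → DiffOp (FractionRing A)) :
    ∃ s : A, s ≠ 0 ∧ ∀ i, a i * const (algebraMap A (FractionRing A) s) ∈ (toFrac A).range := by
  choose s hs has using fun i => exists_mul_const_mem_range (a i)
  refine ⟨∏ i, s i, Finset.prod_ne_zero_iff.2 fun i _ => hs i, fun i => ?_⟩
  obtain ⟨t, ht⟩ := Finset.dvd_prod_of_mem s (Finset.mem_univ i)
  rw [ht, map_mul, const_mul, ← mul_assoc]
  exact mul_mem (has i) ⟨const t, mapHom_const _ _ _⟩

end Denominators

end DiffOp

/-! ### The λ-bracket through symbols, and central elements. -/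

section Central

variable {F : Type*} [Field F] {ℓ m : ℕ}

theorem coeff_coeffDeriv (p : Polynomial (DiffPoly F ℓ)) (n : ℕ) :
    (coeffDeriv p).coeff n = (p.coeff n)′ := by
  rw [coeffDeriv, Polynomial.sum_def, Polynomial.finsetSum_coeff]
  simp only [Polynomial.coeff_monomial, Finset.sum_ite_eq', Polynomial.mem_support_iff]
  split_ifs with h
  · rfl
  · rw [Polynomial.notMem_support_iff.1 h, map_zero]

open DiffOp in
-- Under the symbol, `λ + ∂` becomes left composition with `∂`; this turns the Master Formula into
-- composition of operators.
theorem lamAddDeriv_symbol (a : DiffOp (DiffPoly F ℓ)) :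
    lamAddDeriv (symbol a) = (del * a).symbol := by
  ext1 n
  rw [lamAddDeriv, Polynomial.coeff_add, coeff_coeffDeriv, coeff_symbol, coeff_symbol]
  rcases n with _ | n
  · rw [Polynomial.coeff_X_mul_zero, zero_add, coeff_del_mul_zero]
  · rw [Polynomial.coeff_X_mul, coeff_symbol, coeff_del_mul_succ]

open DiffOp in
theorem lamAddDeriv_iterate_symbol (a : DiffOp (DiffPoly F ℓ)) (k : ℕ) :
    lamAddDeriv^[k] (symbol a) = (del ^ k * a).symbol := by
  induction k with
  | zero => simp
  | succ k ih => rw [Function.iterate_succ_apply', ih, lamAddDeriv_symbol, pow_succ', mul_assoc]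

open DiffOp in
theorem actShift_symbol (a b : DiffOp (DiffPoly F ℓ)) :
    actShift a (symbol b) = (a * b).symbol := by
  obtain ⟨N, hN⟩ := a.exists_coeff_bound
  rw [actShift, finsum_eq_sum_of_support_subset (s := Finset.range N)]
  · conv_rhs => rw [eq_sum hN, Finset.sum_mul, map_sum]
    exact Finset.sum_congr rfl fun k _ => by
      rw [lamAddDeriv_iterate_symbol, C_mul_symbol, mul_assoc]
  · intro k hk
    by_contra h
    exact hk (by simp [hN k (by simpa using h)])

open DiffOp in
theorem frechet_eq_sum (θ : Fin m → DiffPoly F ℓ) (α : Fin m) (j : Fin ℓ) :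
    frechet θ α j = ∑ y ∈ (θ α).vars,
      if y.1 = j then const (MvPolynomial.pderiv y (θ α)) * del ^ y.2 else 0 := by
  refine ext fun n => ?_
  have h1 : (frechet θ α j).coeff n = MvPolynomial.pderiv (j, n) (θ α) := by
    change (if 0 ≤ (n : ℤ) then MvPolynomial.pderiv (j, (n : ℤ).toNat) (θ α) else 0) = _
    rw [if_pos (Int.natCast_nonneg n), Int.toNat_natCast]
  rw [h1, coeff_sum]
  have h2 : ∀ y : Fin ℓ × ℕ, (if y.1 = j then const (MvPolynomial.pderiv y (θ α)) * del ^ y.2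
      else 0).coeff n = if y = (j, n) then MvPolynomial.pderiv y (θ α) else 0 := by
    rintro ⟨i, k⟩
    by_cases hi : i = j
    · simp [hi, coeff_const_mul_del_pow, eq_comm]
    · simp [hi, DiffOp.coeff_zero]
  simp only [h2]
  rw [Finset.sum_ite_eq']
  split_ifs with h
  · rfl
  · exact MvPolynomial.pderiv_eq_zero_of_notMem_vars h

open DiffOp in
/-- The bracket of a variable with `θ` is the symbol of `D_θ ∘ H`. -/
theorem lamBracket_X (H : Matrix (Fin ℓ) (Fin ℓ) (DiffOp (DiffPoly F ℓ)))
    (θ : Fin m → DiffPoly F ℓ) (α : Fin m) (i : Fin ℓ) :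
    lamBracket H (MvPolynomial.X (i, 0)) (θ α) = ((frechet θ * H) α i).symbol := by
  have h : (frechet θ * H) α i = ∑ y ∈ (θ α).vars,
      const (MvPolynomial.pderiv y (θ α)) * (del ^ y.2 * H y.1 i) := by
    rw [Matrix.mul_apply]
    simp only [frechet_eq_sum, Finset.sum_mul]
    rw [Finset.sum_comm]
    refine Finset.sum_congr rfl fun y _ => ?_
    simp [ite_mul, mul_assoc]
  rw [h, map_sum, lamBracket]
  refine Finset.sum_congr rfl fun y _ => ?_
  -- A single variable of order zero contributes only the constant `1`, the symbol of the identity.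
  rw [MvPolynomial.vars_X, Finset.sum_singleton, MvPolynomial.pderiv_X_self,
    Function.iterate_zero_apply, map_one, ← symbol_one, actShift_symbol, mul_one,
    lamAddDeriv_iterate_symbol, C_mul_symbol]

theorem frechet_mul_eq_zero {H : Matrix (Fin ℓ) (Fin ℓ) (DiffOp (DiffPoly F ℓ))}
    {θ : Fin m → DiffPoly F ℓ} (hθ : ∀ α, IsCentral H (θ α)) : frechet θ * H = 0 := by
  ext1 α i
  refine DiffOp.symbol_injective ?_
  rw [← lamBracket_X, (hθ α _).1, Matrix.zero_apply, map_zero]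

end Central

/-! ### Matrices of differential operators: adjoint and action. -/

section MatrixOperators

variable {R : Type*} [CommRing R] [Differential R] {ι κ μ : Type*}

theorem toPsDO_mul [Fintype κ] (A : Matrix ι κ (DiffOp R)) (B : Matrix κ μ (DiffOp R)) :
    toPsDO (A * B) = toPsDO A * toPsDO B :=
  Matrix.map_mul (f := (diffOps R).subtype)

theorem toPsDO_add (A B : Matrix ι κ (DiffOp R)) : toPsDO (A + B) = toPsDO A + toPsDO B := rfl

theorem toPsDO_one [DecidableEq ι] : toPsDO (1 : Matrix ι ι (DiffOp R)) = 1 :=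
  Matrix.map_one (diffOps R).subtype (map_zero _) (map_one _)

theorem matAdjoint_mul [Fintype κ] (A : Matrix ι κ (DiffOp R)) (B : Matrix κ μ (DiffOp R)) :
    matAdjoint (A * B) = matAdjoint B * matAdjoint A := by
  ext1 i j
  let adj : DiffOp R →+ DiffOp R := AddMonoidHom.mk' DiffOp.adjoint DiffOp.adjoint_add
  have h : adj (∑ k, A j k * B k i) = ∑ k, adj (A j k * B k i) := map_sum adj _ _
  change ((A * B) j i).adjoint = _
  rw [Matrix.mul_apply, Matrix.mul_apply]
  exact h.trans (Finset.sum_congr rfl fun k _ => DiffOp.adjoint_mul _ _)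

theorem matAdjoint_matAdjoint (A : Matrix ι κ (DiffOp R)) : matAdjoint (matAdjoint A) = A := by
  ext1 i j
  exact DiffOp.adjoint_adjoint _

theorem matAdjoint_one [DecidableEq ι] : matAdjoint (1 : Matrix ι ι (DiffOp R)) = 1 := by
  have h0 : DiffOp.adjoint (0 : DiffOp R) = 0 := by
    rw [← DiffOp.const_zero, DiffOp.adjoint_const]
  have h1 : DiffOp.adjoint (1 : DiffOp R) = 1 := by
    rw [← DiffOp.const_one, DiffOp.adjoint_const]
  rw [matAdjoint, Matrix.transpose_one, Matrix.map_one _ h0 h1]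

variable {S : Type*} [CommRing S] [Differential S]

theorem matAct_add [Fintype κ] (φ : R →+* S) (A B : Matrix ι κ (DiffOp R)) (f : κ → S) :
    matAct φ (A + B) f = matAct φ A f + matAct φ B f := by
  ext i
  simp only [matAct, Matrix.add_apply, DiffOp.add_act, Finset.sum_add_distrib, Pi.add_apply]

theorem matAct_zero_matrix [Fintype κ] (φ : R →+* S) (f : κ → S) :
    matAct φ (0 : Matrix ι κ (DiffOp R)) f = 0 := by
  ext i
  simp [matAct, DiffOp.zero_act]

theorem matAct_neg [Fintype κ] (φ : R →+* S) (A : Matrix ι κ (DiffOp R)) (f : κ → S) :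
    matAct φ (-A) f = -matAct φ A f := by
  refine eq_neg_of_add_eq_zero_left ?_
  rw [← matAct_add, neg_add_cancel, matAct_zero_matrix]

theorem matAct_zero [Fintype κ] (φ : R →+* S) (A : Matrix ι κ (DiffOp R)) : matAct φ A 0 = 0 := by
  ext i
  simp [matAct, DiffOp.act_zero]

theorem matAct_one [Fintype ι] [DecidableEq ι] (φ : R →+* S) (f : ι → S) :
    matAct φ (1 : Matrix ι ι (DiffOp R)) f = f := by
  ext i
  rw [matAct, Finset.sum_eq_single i]
  · rw [Matrix.one_apply_eq, DiffOp.one_act]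
  · intro j _ hj
    rw [Matrix.one_apply_ne hj.symm, DiffOp.zero_act]
  · simp

theorem matAct_mul [Fintype κ] [Fintype μ] {φ : R →+* S} (hφ : ∀ x, φ x′ = (φ x)′)
    (A : Matrix ι κ (DiffOp R)) (B : Matrix κ μ (DiffOp R)) (f : μ → S) :
    matAct φ (A * B) f = matAct φ A (matAct φ B f) := by
  ext i
  have h1 : ∀ j, (∑ k, A i k * B k j).act φ (f j) = ∑ k, (A i k * B k j).act φ (f j) := fun j =>
    map_sum (AddMonoidHom.mk' (fun a : DiffOp R => a.act φ (f j))
      fun a b => DiffOp.add_act φ a b (f j)) _ _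
  have h2 : ∀ k, (A i k).act φ (∑ j, (B k j).act φ (f j)) =
      ∑ j, (A i k).act φ ((B k j).act φ (f j)) := fun k =>
    map_sum (AddMonoidHom.mk' ((A i k).act φ) (DiffOp.act_add φ (A i k))) _ _
  simp only [matAct, Matrix.mul_apply, h1, h2, DiffOp.mul_act hφ]
  exact Finset.sum_comm

/-- The module structure given by the action of differential operators. -/
abbrev actModule (φ : R →+* S) (hφ : ∀ x, φ x′ = (φ x)′) : Module (DiffOp R) S where
  smul a f := a.act φ f
  one_smul := DiffOp.one_act φ
  mul_smul a b f := DiffOp.mul_act hφ a b f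
  smul_zero := DiffOp.act_zero φ
  smul_add := DiffOp.act_add φ
  add_smul := DiffOp.add_act φ
  zero_smul := DiffOp.zero_act φ

end MatrixOperators

/-! ### Completion of `(B* -C)` to an invertible matrix. -/

section Coprime

variable {K L : Type*} [Field K] [Differential K] [Field L] [Differential L]

/-- Used to move the pivot rows to the top; the complement of the range of `e` has exactly `ℓ`
elements. -/
theorem exists_equiv_extending {ι : Type*} [Fintype ι] {m ℓ : ℕ} (hι : Fintype.card ι = ℓ + m)
    (e : Fin m → ι) (he : Function.Injective e) :
    ∃ τ : Fin m ⊕ Fin ℓ ≃ ι, ∀ j, τ (Sum.inl j) = e j := by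
  classical
  have h1 : Fintype.card ↥(Set.range e)ᶜ = ℓ := by
    rw [Fintype.card_compl_set, Set.card_range_of_injective he, hι, Fintype.card_fin,
      Nat.add_sub_cancel]
  refine ⟨(Equiv.sumCongr (Equiv.ofInjective e he) (Fintype.equivFinOfCardEq h1).symm).trans
    (Equiv.Set.sumCompl (Set.range e)), fun j => ?_⟩
  simp

/-- If `B` and a skewadjoint `C` have no common kernel in a linearly closed extension, then the
matrix `(B* -C)` is the upper part of an invertible matrix. -/
theorem exists_complement {φ : K →+* L} (hφ : ∀ x, φ x′ = (φ x)′)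
    (hL : IsLinearlyClosed (⊤ : Subfield L)) {ℓ m : ℕ} (B : Matrix (Fin ℓ) (Fin m) (DiffOp K))
    (C : Matrix (Fin m) (Fin m) (DiffOp K)) (hC : matAdjoint C = -C)
    (hker : ∀ f : Fin m → L, matAct φ B f = 0 → matAct φ C f = 0 → f = 0) :
    ∃ (N : Matrix (Fin ℓ) (Fin ℓ) (DiffOp K)) (M : Matrix (Fin m) (Fin ℓ) (DiffOp K))
      (Q : Matrix (Fin ℓ) (Fin m) (DiffOp K)) (T : Matrix (Fin m) (Fin m) (DiffOp K))
      (X : Matrix (Fin ℓ) (Fin ℓ) (DiffOp K)) (Y : Matrix (Fin ℓ) (Fin m) (DiffOp K)),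
      X * N + Y * M = 1 ∧ Q * matAdjoint B + N * X = 1 ∧ Q * C = N * Y ∧
        T * matAdjoint B + M * X = 0 ∧ matAdjoint B * N = C * M := by
  let := actModule φ hφ
  obtain ⟨W, e, he, hWA⟩ := exists_unit_mul_eq (M := L) (ι := Fin ℓ ⊕ Fin m) DiffOp.size
    DiffOp.exists_size_sub_mul_lt (DiffOp.isUnit_of_act_injective φ hL) (m := m) (by simp)
    (Matrix.fromRows B C)
    (fun f hf => hker f (funext fun i => hf (Sum.inl i)) (funext fun i => hf (Sum.inr i)))
  obtain ⟨τ, hτ⟩ := exists_equiv_extending (ℓ := ℓ) (by simp) e he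
  -- Since `W` sends the columns of the stacked matrix to basis vectors, these columns are columns
  -- of `W⁻¹`.
  have hZ : ∀ i j, W⁻¹.1 i (τ (Sum.inl j)) = Matrix.fromRows B C i j := by
    intro i j
    have h : Matrix.fromRows B C = W⁻¹.1 * (W.1 * Matrix.fromRows B C) := by
      rw [← Matrix.mul_assoc, ← Units.val_mul, inv_mul_cancel, Units.val_one, Matrix.one_mul]
    rw [h, Matrix.mul_apply, hτ]
    simp [hWA]
  -- Adjoints turn the columns `B`, `C` of `W⁻¹` into the rows `B*`, `C* = -C` at the top of `V`,
  -- with `U = V⁻¹`.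
  let U := matAdjoint (W.1.submatrix τ id)
  let V := matAdjoint (W⁻¹.1.submatrix id τ)
  have hUV : U * V = 1 := by
    rw [← matAdjoint_mul]
    have h : W⁻¹.1.submatrix id τ * W.1.submatrix τ id = 1 := by
      rw [Matrix.submatrix_mul_equiv, ← Units.val_mul, inv_mul_cancel, Units.val_one,
        Matrix.submatrix_id_id]
    rw [h, matAdjoint_one]
  have hVU : V * U = 1 := by
    rw [← matAdjoint_mul]
    have h : W.1.submatrix τ id * W⁻¹.1.submatrix id τ = 1 := by
      rw [← Matrix.submatrix_mul _ _ _ _ _ Function.bijective_id, ← Units.val_mul, mul_inv_cancel,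
        Units.val_one, Matrix.submatrix_one_equiv]
    rw [h, matAdjoint_one]
  have hB : V.toBlocks₁₁ = matAdjoint B := by
    ext1 j i
    exact congrArg DiffOp.adjoint (hZ (Sum.inl i) j)
  have hC' : V.toBlocks₁₂ = -C := by
    rw [← hC]
    ext1 j i
    exact congrArg DiffOp.adjoint (hZ (Sum.inr i) j)
  rw [← Matrix.fromBlocks_toBlocks U, ← Matrix.fromBlocks_toBlocks V, Matrix.fromBlocks_multiply,
    ← Matrix.fromBlocks_one, Matrix.fromBlocks_inj, hB, hC'] at hUV hVU
  obtain ⟨h1, h2, h3, -⟩ := hUV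
  obtain ⟨-, h6, -, h8⟩ := hVU
  -- With rows `(Q N)`, `(T M)` for `U` and `(B* -C)`, `(X Y)` for `V`, the claims are blocks of `U
  -- V = 1` and `V U = 1`.
  refine ⟨U.toBlocks₁₂, U.toBlocks₂₂, U.toBlocks₁₁, U.toBlocks₂₁, V.toBlocks₂₁, V.toBlocks₂₂,
    h8, h1, ?_, h3, ?_⟩
  · rw [Matrix.mul_neg, neg_add_eq_zero] at h2
    exact h2
  · rw [Matrix.neg_mul, add_neg_eq_zero] at h6
    exact h6

end Coprime

/-! ### Association relations and the Dirac modification. -/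

section Association

variable {F : Type*} [Field F] {ℓ m : ℕ}

theorem overFrac_toPsDO (A : Matrix (Fin ℓ) (Fin ℓ) (DiffOp (DiffPoly F ℓ))) :
    overFrac (toPsDO A) = toPsDO (A.map (DiffOp.toFrac _)) := rfl

/-- Association for a local operator is application of the operator. -/
theorem IsAssociated.eq_matAct {H : Matrix (Fin ℓ) (Fin ℓ) (DiffOp (DiffPoly F ℓ))}
    {ξ P : Fin ℓ → DiffPoly F ℓ} (h : IsAssociated (toPsDO H) ξ P) :
    (fun i => algebraMap _ (FractionRing (DiffPoly F ℓ)) (P i)) =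
      matAct (algebraMap _ _) H fun i => algebraMap _ (FractionRing (DiffPoly F ℓ)) (ξ i) := by
  obtain ⟨A, B, ⟨hB, hAB⟩, f, hξ, hP⟩ := h
  rw [Ring.eq_mul_inverse_iff_mul_eq _ _ _ hB, overFrac_toPsDO, overFrac_toPsDO, overFrac_toPsDO,
    ← toPsDO_mul, ← Matrix.map_mul] at hAB
  -- The identity over the fraction field descends to `V[∂]`, which embeds in `K[∂]`.
  have hHB : H * B = A := by
    ext1 i j
    exact DiffOp.toFrac_injective (Subtype.ext (congrFun (congrFun hAB i) j))
  rw [hξ, hP, ← hHB, matAct_mul DiffOp.algebraMap_deriv]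

theorem matAdjoint_map_toFrac {ι κ : Type*} (A : Matrix ι κ (DiffOp (DiffPoly F ℓ))) :
    matAdjoint (A.map (DiffOp.toFrac _)) = (matAdjoint A).map (DiffOp.toFrac _) := by
  ext1 i j
  exact (DiffOp.mapHom_adjoint _ _ _).symm

/-- Association for the Dirac modification, at the vectors `ξ` in the kernel of `B*`. -/
theorem isAssociated_diracModification {H : Matrix (Fin ℓ) (Fin ℓ) (DiffOp (DiffPoly F ℓ))}
    (hH : matAdjoint H = -H) (θ : Fin m → DiffPoly F ℓ) (hC : IsUnit (toPsDO (diracC H θ)))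
    {L : Type*} [Field L] [Differential L] {φ : FractionRing (DiffPoly F ℓ) →+* L}
    (hφ : ∀ x, φ x′ = (φ x)′) (hL : IsLinearlyClosed (⊤ : Subfield L))
    (hker : ∀ f : Fin m → L, matAct (φ.comp (algebraMap _ _)) (diracB H θ) f = 0 →
      matAct (φ.comp (algebraMap _ _)) (diracC H θ) f = 0 → f = 0)
    {ξ P : Fin ℓ → DiffPoly F ℓ}
    (hξ : matAct (algebraMap _ (FractionRing (DiffPoly F ℓ))) (matAdjoint (diracB H θ))
      (fun i => algebraMap _ _ (ξ i)) = 0)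
    (hP : (fun i => algebraMap _ (FractionRing (DiffPoly F ℓ)) (P i)) =
      matAct (algebraMap _ _) H fun i => algebraMap _ _ (ξ i)) :
    IsAssociated (diracModification H θ) ξ P := by
  set B := diracB H θ
  set C := diracC H θ with hCdef
  have hCskew : matAdjoint C = -C := by
    rw [hCdef, diracC, matAdjoint_mul, matAdjoint_mul, matAdjoint_matAdjoint, hH, Matrix.neg_mul,
      Matrix.mul_neg, Matrix.mul_assoc]
  obtain ⟨N, M, Q, T, X, Y, h1, h2, h3, h4, h5⟩ := exists_complement hφ hL
    (B.map (DiffOp.toFrac _)) (C.map (DiffOp.toFrac _))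
    (by rw [matAdjoint_map_toFrac, hCskew]; ext1 i j; exact map_neg (DiffOp.toFrac _) _) hker
  rw [matAdjoint_map_toFrac] at h2 h4 h5
  -- One denominator for all entries of `N` and `M`, so that both are multiplied on the right by the
  -- same scalar matrix `S`.
  obtain ⟨s, hs, hsNM⟩ := DiffOp.exists_forall_mul_const_mem_range
    (α := (Fin ℓ × Fin ℓ) ⊕ (Fin m × Fin ℓ))
    (Sum.elim (fun p => N p.1 p.2) fun p => M p.1 p.2)
  set r := algebraMap _ (FractionRing (DiffPoly F ℓ)) s with hr
  have hr0 : r ≠ 0 := (map_ne_zero_iff _ (IsFractionRing.injective _ _)).2 hs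
  choose N₀ hN₀ using fun i j => hsNM (Sum.inl (i, j))
  choose M₀ hM₀ using fun i j => hsNM (Sum.inr (i, j))
  let S : Matrix (Fin ℓ) (Fin ℓ) (DiffOp (FractionRing (DiffPoly F ℓ))) :=
    Matrix.diagonal fun _ => DiffOp.const r
  let S' : Matrix (Fin ℓ) (Fin ℓ) (DiffOp (FractionRing (DiffPoly F ℓ))) :=
    Matrix.diagonal fun _ => DiffOp.const r⁻¹
  have hSS' : S * S' = 1 := by
    simp only [S, S', Matrix.diagonal_mul_diagonal, ← DiffOp.const_mul, mul_inv_cancel₀ hr0,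
      DiffOp.const_one, Matrix.diagonal_one]
  have hS'S : S' * S = 1 := by
    simp only [S, S', Matrix.diagonal_mul_diagonal, ← DiffOp.const_mul, inv_mul_cancel₀ hr0,
      DiffOp.const_one, Matrix.diagonal_one]
  have hN : (Matrix.of N₀).map (DiffOp.toFrac _) = N * S := by
    ext1 i j
    rw [Matrix.mul_diagonal]
    exact hN₀ i j
  have hM : (Matrix.of M₀).map (DiffOp.toFrac _) = M * S := by
    ext1 i j
    rw [Matrix.mul_diagonal]
    exact hM₀ i j
  let ψ : PsDO (DiffPoly F ℓ) →+* PsDO (FractionRing (DiffPoly F ℓ)) :=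
    PsDO.mapHom (algebraMap _ _) DiffOp.algebraMap_deriv
  set c' := (Ring.inverse (toPsDO C)).map ψ with hc'
  have hcc' : toPsDO (C.map (DiffOp.toFrac _)) * c' = 1 := by
    have h : toPsDO (C.map (DiffOp.toFrac _)) = (toPsDO C).map ψ := rfl
    rw [h, hc', ← Matrix.map_mul, Ring.mul_inverse_cancel _ hC,
      Matrix.map_one _ (map_zero _) (map_one _)]
  have hc'c : c' * toPsDO (C.map (DiffOp.toFrac _)) = 1 := by
    have h : toPsDO (C.map (DiffOp.toFrac _)) = (toPsDO C).map ψ := rfl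
    rw [h, hc', ← Matrix.map_mul, Ring.inverse_mul_cancel _ hC,
      Matrix.map_one _ (map_zero _) (map_one _)]
  have hD : overFrac (diracModification H θ) = toPsDO (H.map (DiffOp.toFrac _)) +
      toPsDO (B.map (DiffOp.toFrac _)) * c' *
        toPsDO ((matAdjoint B).map (DiffOp.toFrac _)) := by
    have h : overFrac (diracModification H θ) = (diracModification H θ).map ψ := rfl
    rw [h, diracModification, Matrix.map_add ψ (map_add ψ), Matrix.map_mul, Matrix.map_mul]
    rfl
  have hb : toPsDO ((matAdjoint B).map (DiffOp.toFrac _)) * toPsDO N =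
      toPsDO (C.map (DiffOp.toFrac _)) * toPsDO M := by
    rw [← toPsDO_mul, h5, toPsDO_mul]
  have hcb : c' * (toPsDO ((matAdjoint B).map (DiffOp.toFrac _)) * toPsDO N) = toPsDO M := by
    rw [hb, ← Matrix.mul_assoc, hc'c, Matrix.one_mul]
  -- The inverse is `X + Y C⁻¹ B*`: on the right of `N` use `N Y = Q C`, on the left use `C⁻¹ B* N =
  -- M`.
  have hunitN : IsUnit (toPsDO N) := by
    refine ⟨⟨toPsDO N, toPsDO X + toPsDO Y * c' *
      toPsDO ((matAdjoint B).map (DiffOp.toFrac _)), ?_, ?_⟩, rfl⟩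
    · rw [Matrix.mul_add, ← Matrix.mul_assoc, ← Matrix.mul_assoc, ← toPsDO_mul, ← toPsDO_mul, ← h3,
        toPsDO_mul Q, Matrix.mul_assoc (toPsDO Q), hcc', Matrix.mul_one, ← toPsDO_mul,
        ← toPsDO_add, add_comm, h2, toPsDO_one]
    · rw [Matrix.add_mul, Matrix.mul_assoc, Matrix.mul_assoc, hcb, ← toPsDO_mul, ← toPsDO_mul,
        ← toPsDO_add, h1, toPsDO_one]
  have hunitS : IsUnit (toPsDO S) :=
    ⟨⟨toPsDO S, toPsDO S', by rw [← toPsDO_mul, hSS', toPsDO_one],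
      by rw [← toPsDO_mul, hS'S, toPsDO_one]⟩, rfl⟩
  have hunit : IsNondegenerate (Matrix.of N₀) := by
    rw [IsNondegenerate, overFrac_toPsDO, hN, toPsDO_mul]
    exact hunitN.mul hunitS
  have hid : ∀ x : FractionRing (DiffPoly F ℓ), RingHom.id _ x′ = (RingHom.id _ x)′ := fun _ => rfl
  set ξ' : Fin ℓ → FractionRing (DiffPoly F ℓ) := fun i => algebraMap _ _ (ξ i)
  have hξ0 : matAct (RingHom.id _) ((matAdjoint B).map (DiffOp.toFrac _)) ξ' = 0 := hξ
  -- The vector `X ξ` corrected by `S⁻¹`. As `B* ξ = 0`, the relations `Q B* + N X = 1` and `T B* +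
  -- M X = 0` give `N X ξ = ξ` and `M X ξ = 0`.
  let f : Fin ℓ → FractionRing (DiffPoly F ℓ) :=
    matAct (RingHom.id _) S' (matAct (RingHom.id _) X ξ')
  have hSf : matAct (RingHom.id _) S f = matAct (RingHom.id _) X ξ' := by
    rw [← matAct_mul hid, hSS', matAct_one]
  have hNf : matAct (algebraMap _ _) (Matrix.of N₀) f = ξ' := by
    change matAct (RingHom.id _) ((Matrix.of N₀).map (DiffOp.toFrac _)) f = _
    have h := congrArg (fun A => matAct (RingHom.id _) A ξ') h2
    simp only [matAct_add, matAct_mul hid, hξ0, matAct_zero, zero_add, matAct_one] at h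
    rw [hN, matAct_mul hid, hSf, h]
  have hMf : matAct (algebraMap _ _) (Matrix.of M₀) f = 0 := by
    change matAct (RingHom.id _) ((Matrix.of M₀).map (DiffOp.toFrac _)) f = _
    have h := congrArg (fun A => matAct (RingHom.id _) A ξ') h4
    simp only [matAct_add, matAct_mul hid, hξ0, matAct_zero, zero_add, matAct_zero_matrix] at h
    rw [hM, matAct_mul hid, hSf, h]
  -- The numerator is `H^D N₀`, in which `C⁻¹ B* N₀ = M₀`.
  refine ⟨H * Matrix.of N₀ + B * Matrix.of M₀, Matrix.of N₀, ⟨hunit, ?_⟩, f, hNf.symm, ?_⟩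
  · rw [Ring.eq_mul_inverse_iff_mul_eq _ _ _ hunit, hD, overFrac_toPsDO, overFrac_toPsDO, hN,
      Matrix.map_add _ (map_add _), Matrix.map_mul, Matrix.map_mul, hN, hM, toPsDO_add]
    simp only [toPsDO_mul]
    rw [← hcb]
    simp only [Matrix.add_mul, Matrix.mul_assoc]
  · rw [hP, matAct_add, matAct_mul DiffOp.algebraMap_deriv, matAct_mul DiffOp.algebraMap_deriv, hNf,
      hMf, matAct_zero, add_zero]

theorem IsBiPoisson.right {H₀ H₁ : Matrix (Fin ℓ) (Fin ℓ) (DiffOp (DiffPoly F ℓ))}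
    (h : IsBiPoisson H₀ H₁) : IsPoisson H₁ := by
  have := h 0 1
  rwa [map_zero, map_one, DiffOp.const_zero, DiffOp.const_one, zero_smul, one_smul,
    zero_add] at this

end Association

end DiracReduction

end

open DiracReduction in
theorem proposition20131203 {F : Type*} [Field F] [CharZero F] {ℓ m : ℕ}
    (H₀ H₁ : Matrix (Fin ℓ) (Fin ℓ) (DiffOp (DiffPoly F ℓ))) (hH : IsBiPoisson H₀ H₁)
    (h : ℤ → DiffPoly F ℓ) (P : ℕ → Fin ℓ → DiffPoly F ℓ)
    (hLM : LenardMagri (toPsDO H₀) (toPsDO H₁) h P)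
    (θ : Fin m → DiffPoly F ℓ) (hθ : ∀ α, IsCentral H₀ (θ α))
    (hC : IsUnit (toPsDO (diracC H₁ θ)))
    {L : Type*} [Field L] [Differential L] [Algebra (FractionRing (DiffPoly F ℓ)) L]
    (hL : IsLinearClosure (FractionRing (DiffPoly F ℓ)) L)
    (hker : ∀ f : Fin m → L,
      matAct ((algebraMap (FractionRing (DiffPoly F ℓ)) L).comp (algebraMap _ _))
        (diracB H₁ θ) f = 0 →
      matAct ((algebraMap (FractionRing (DiffPoly F ℓ)) L).comp (algebraMap _ _))
        (diracC H₁ θ) f = 0 → f = 0) :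
    LenardMagri (toPsDO H₀) (diracModification H₁ θ) h P := by
  intro n
  obtain ⟨h1, h0⟩ := hLM n
  have hskew := hH.right.skewadjoint
  have hP1 := h1.eq_matAct
  refine ⟨isAssociated_diracModification hskew θ hC
    (fun x => (hL.differentialAlgebra.deriv_algebraMap x).symm) hL.linearlyClosed hker ?_ hP1, h0⟩
  -- `B* ξ = -D_θ H₁ ξ = -D_θ P_n = -D_θ H₀ (δh_n/δu) = 0`.
  rw [diracB, matAdjoint_mul, matAdjoint_matAdjoint, hskew, Matrix.mul_neg, matAct_neg,
    matAct_mul DiffOp.algebraMap_deriv, ← hP1, h0.eq_matAct, ← matAct_mul DiffOp.algebraMap_deriv,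
    frechet_mul_eq_zero hθ, matAct_zero_matrix, neg_zero]
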